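/- Write $\mathcal O_m=\mathcal O_{\mathbb C^m,0}$ for the ring of germs at $0$ of holomorphic functions on $\mathbb C^m$. Let $f:(\mathbb C^n,0)\to(\mathbb C^{n+1},0)$ be a finite holomorphic map-germ (i.e. $\mathcal O_n$ is a finitely generated $\mathcal O_{n+1}$-module through $f^*:g\mapsto g\circ f$) which is weighted homogeneous: for some positive integer weights of the variables, its components are weighted homogeneous polynomials of positive degrees. Let $(X,0)$ be the image of $f$ and let $h\in\mathcal O_{n+1}$ be a defining equation of it, i.e. a generator of the ideal $\ker f^*$ of germs vanishing on $X$; put $\mathcal O_{X,0}=\mathcal O_{n+1}/(h)$, which $f^*$ embeds into $\mathcal O_n$. Let $J_h\subseteq\mathcal O_{n+1}$ be the ideal generated by the partial derivatives of $h$, let $(f^*J_h)\mathcal O_n$ be the ideal of $\mathcal O_n$ generated by $f^*(J_h)$, let $J_h\mathcal O_{X,0}=f^*(J_h)\subseteq\mathcal O_n$ be the ideal of $\mathcal O_{X,0}$ generated by $J_h$, and let $$N_f=\frac{(f^*J_h)\mathcal O_n}{J_h\mathcal O_{X,0}} .$$ 1. Suppose that $f$ is bimeromorphic onto its image (generically one-to-one),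 i.e. every element of $\mathcal O_n$ is a quotient of two elements of $\mathcal O_{X,0}$. Then $g\mapsto f^*g$ induces an isomorphism of $\mathcal O_{n+1}$-modules $$\frac{(f^*)^{-1}\big((f^*J_h)\mathcal O_n\big)}{J_h}\;\cong\; N_f .$$ 2. Suppose that the ramification locus of $f$, defined by the ideal of $n\times n$-minors of the Jacobian matrix $df$, has codimension at least $2$ in $(\mathbb C^n,0)$ (the empty locus having codimension $\infty$). Then $$\dim_{\mathbb C}N_f=\mathcal A_e\text{-}\mathrm{codim}(f):=\dim_{\mathbb C}\frac{\mathcal O_n^{\,n+1}}{\{df(\xi)\mid\xi\in\mathcal O_n^{\,n}\}+\{\eta\circ f\mid \eta\in\mathcal O_{n+1}^{\,n+1}\}} ,$$ an equality of (possibly infinite) dimensions. -/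

import Mathlib

open Filter Topology

noncomputable section

namespace MondGerm

/-! ### Germs of holomorphic functions -/

/-- Germs at `0 ∈ ℂⁿ` of arbitrary functions form a `ℂ`-algebra. -/
instance germAlgebra (n : ℕ) : Algebra ℂ (Germ (𝓝 (0 : Fin n → ℂ)) ℂ) :=
  Algebra.ofModule
    (fun r x y => by
      induction x using Germ.inductionOn with | _ F =>
      induction y using Germ.inductionOn with | _ G =>
      exact congrArg Germ.ofFun (smul_mul_assoc r F G))
    (fun r x y => by
      induction x using Germ.inductionOn with | _ F =>
      induction y using Germ.inductionOn with | _ G =>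
      exact congrArg Germ.ofFun (mul_smul_comm r F G))

/-- The algebra of germs at `0 ∈ ℂⁿ` that have a holomorphic representative. -/
def holSubalgebra (n : ℕ) : Subalgebra ℂ (Germ (𝓝 (0 : Fin n → ℂ)) ℂ) where
  carrier := {g | ∃ F : (Fin n → ℂ) → ℂ, AnalyticAt ℂ F 0 ∧ (Germ.ofFun F : Germ (𝓝 (0 : Fin n → ℂ)) ℂ) = g}
  mul_mem' := by
    rintro _ _ ⟨F, hF, rfl⟩ ⟨G, hG, rfl⟩
    exact ⟨F * G, hF.mul hG, rfl⟩
  add_mem' := by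
    rintro _ _ ⟨F, hF, rfl⟩ ⟨G, hG, rfl⟩
    exact ⟨F + G, hF.add hG, rfl⟩
  algebraMap_mem' := by
    intro r
    refine ⟨fun _ => r, analyticAt_const, ?_⟩
    rw [Algebra.algebraMap_eq_smul_one]
    refine congrArg Germ.ofFun (?_ : (fun _ => r) = r • (1 : (Fin n → ℂ) → ℂ))
    ext x
    simp

/-- The ring `𝒪_{ℂⁿ,0}` of germs at `0` of holomorphic functions on `ℂⁿ`. -/
def O (n : ℕ) : Type := holSubalgebra n

instance (n : ℕ) : CommRing (O n) := inferInstanceAs (CommRing (holSubalgebra n))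

instance (n : ℕ) : Algebra ℂ (O n) := inferInstanceAs (Algebra ℂ (holSubalgebra n))

/-- The germ at `0` of a function that is holomorphic near `0`. -/
def O.mk {n : ℕ} (F : (Fin n → ℂ) → ℂ) (hF : AnalyticAt ℂ F 0) : O n :=
  ⟨Germ.ofFun F, F, hF, rfl⟩

/-- The partial derivative `∂g/∂x_i` of a germ of functions. -/
def germPDeriv {n : ℕ} (i : Fin n) :
    Germ (𝓝 (0 : Fin n → ℂ)) ℂ → Germ (𝓝 (0 : Fin n → ℂ)) ℂ :=
  Germ.map' (fun (F : (Fin n → ℂ) → ℂ) x => fderiv ℂ F x (Pi.single i 1)) (fun _ _ h => by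
    filter_upwards [h.fderiv (𝕜 := ℂ)] with x hx
    rw [hx])

/-- The partial derivative `∂g/∂x_i` of a holomorphic germ. -/
def pderiv {n : ℕ} (i : Fin n) (g : O n) : O n :=
  ⟨germPDeriv i g.1, by
    obtain ⟨_, F, hF, rfl⟩ := g
    exact ⟨fun x => fderiv ℂ F x (Pi.single i 1), 
      ((ContinuousLinearMap.apply ℂ ℂ (Pi.single i 1 : Fin n → ℂ)).analyticAt _).comp hF.fderiv, rfl⟩⟩

/-! ### Map-germs -/

/-- (A representative of) a holomorphic map-germ `(ℂⁿ,0) → (ℂᵖ,0)`. All notions below depend only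
on the germ of `toFun` at `0`. -/
structure MapGerm (n p : ℕ) where
  toFun : (Fin n → ℂ) → (Fin p → ℂ)
  analyticAt : AnalyticAt ℂ toFun 0
  map_zero : toFun 0 = 0

namespace MapGerm

variable {n p : ℕ}

theorem tendsto (f : MapGerm n p) : Tendsto f.toFun (𝓝 0) (𝓝 0) := by
  have h := f.analyticAt.continuousAt.tendsto
  rwa [f.map_zero] at h

/-- The `j`-th component `f_j ∈ 𝒪_{ℂⁿ,0}`. -/
def comp (f : MapGerm n p) (j : Fin p) : O n :=
  O.mk (fun x => f.toFun x j) (analyticAt_pi_iff.1 f.analyticAt j)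

/-- The pull-back `f^* : 𝒪_{ℂᵖ,0} → 𝒪_{ℂⁿ,0}`, `g ↦ g ∘ f`. -/
def pullback (f : MapGerm n p) : O p →ₐ[ℂ] O n where
  toFun g := ⟨g.1.compTendsto f.toFun f.tendsto, by
    obtain ⟨_, G, hG, rfl⟩ := g
    exact ⟨G ∘ f.toFun, (by rwa [f.map_zero] : AnalyticAt ℂ G (f.toFun 0)).comp f.analyticAt, rfl⟩⟩
  map_one' := rfl
  map_zero' := rfl
  map_mul' := by
    rintro ⟨_, F, hF, rfl⟩ ⟨_, G, hG, rfl⟩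
    rfl
  map_add' := by
    rintro ⟨_, F, hF, rfl⟩ ⟨_, G, hG, rfl⟩
    rfl
  commutes' _ := rfl

/-- `f_* 𝒪_{ℂⁿ,0}`: the ring `𝒪_{ℂⁿ,0}`, regarded as an algebra over `𝒪_{ℂᵖ,0}` through `f^*`. -/
def PushForward (_f : MapGerm n p) : Type := O n

instance (f : MapGerm n p) : CommRing f.PushForward := inferInstanceAs (CommRing (O n))

instance (f : MapGerm n p) : Algebra ℂ f.PushForward := inferInstanceAs (Algebra ℂ (O n))

instance (f : MapGerm n p) : Algebra (O p) f.PushForward :=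
  RingHom.toAlgebra (S := O n) f.pullback.toRingHom

instance (f : MapGerm n p) : IsScalarTower ℂ (O p) f.PushForward :=
  IsScalarTower.of_algebraMap_eq (fun r => (f.pullback.commutes r).symm)

/-- `f` is finite: `𝒪_{ℂⁿ,0}` is a finitely generated `𝒪_{ℂᵖ,0}`-module through `f^*`. -/
def IsFinite (f : MapGerm n p) : Prop := Module.Finite (O p) f.PushForward

/-- `f` is weighted homogeneous: for some positive integral weights of the variables and positive
integral degrees, every component of `f` is a weighted homogeneous polynomial. -/
def IsWeightedHomogeneous (f : MapGerm n p) : Prop :=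
  ∃ (w : Fin n → ℕ) (d : Fin p → ℕ) (P : Fin p → MvPolynomial (Fin n) ℂ),
    (∀ i, 0 < w i) ∧ (∀ j, 0 < d j) ∧
    (∀ j, MvPolynomial.IsWeightedHomogeneous w (P j) (d j)) ∧
    ∀ᶠ x in 𝓝 (0 : Fin n → ℂ), ∀ j, f.toFun x j = MvPolynomial.eval x (P j)

/-- The ideal of the image `(X,0)` of `f`: the germs that vanish on the image, i.e. the
germs `g` with `g ∘ f = 0`. Thus `𝒪_{X,0} = 𝒪_{ℂᵖ,0} / imageIdeal f`, and `f^*` embeds `𝒪_{X,0}` into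
`𝒪_{ℂⁿ,0}` as the subring `f^* 𝒪_{ℂᵖ,0}`. -/
def imageIdeal (f : MapGerm n p) : Ideal (O p) := RingHom.ker f.pullback

/-- `h` is a defining equation of the image of `f`: it generates the ideal of the image. -/
def IsImageEquation (f : MapGerm n p) (h : O p) : Prop := Ideal.span {h} = f.imageIdeal

/-- `f` is bimeromorphic onto its image `(X,0)`: the inclusion `f^* : 𝒪_{X,0} → 𝒪_{ℂⁿ,0}` is an
isomorphism on fraction fields, that is, every germ in `𝒪_{ℂⁿ,0}` is a quotient of two elements
of `𝒪_{X,0}`. For finite `f` this says that `f` is generically one-to-one. -/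
def IsBimeromorphicOntoImage (f : MapGerm n p) : Prop :=
  ∀ g : O n, ∃ a b : O p, f.pullback b ≠ 0 ∧ f.pullback b * g = f.pullback a

/-- The Jacobian matrix `df = (∂f_j/∂x_i)`, with rows indexed by `j` and columns by `i`. -/
def jacobianMatrix (f : MapGerm n p) : Matrix (Fin p) (Fin n) (O n) :=
  Matrix.of fun j i => pderiv i (f.comp j)

/-- The ideal of the ramification locus `{rank df < n}` of `f : (ℂⁿ,0) → (ℂⁿ⁺¹,0)`, generated by
the `n × n`-minors of `df`; the minor number `j` is obtained by deleting the row `j`. -/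
def ramificationIdeal (f : MapGerm n (n + 1)) : Ideal (O n) :=
  Ideal.span (Set.range fun j : Fin (n + 1) => (f.jacobianMatrix.submatrix j.succAbove id).det)

/-- The codimension in `(ℂⁿ,0)` of the ramification locus of `f`, i.e. the height of its ideal
(`⊤` if the ramification locus is empty). -/
def ramificationCodim (f : MapGerm n (n + 1)) : ℕ∞ := f.ramificationIdeal.height

/-! ### The `𝒜ₑ`-normal space -/

/-- `tf : Θ_{ℂⁿ,0} → f^* Θ_{ℂᵖ,0}`, `ξ ↦ df(ξ)`; the vector field `∑ ξ_i ∂/∂x_i` is given by the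
tuple of its coefficients, and likewise for vector fields along `f`. -/
def tf (f : MapGerm n p) : (Fin n → O n) →ₗ[ℂ] (Fin p → O n) :=
  f.jacobianMatrix.mulVecLin.restrictScalars ℂ

/-- `ωf : Θ_{ℂᵖ,0} → f^* Θ_{ℂᵖ,0}`, `η ↦ η ∘ f`. -/
def ωf (f : MapGerm n p) : (Fin p → O p) →ₗ[ℂ] (Fin p → O n) :=
  f.pullback.toLinearMap.compLeft (Fin p)

/-- The normal space `N𝒜ₑ f = f^*Θ_{ℂᵖ,0} / (tf(Θ_{ℂⁿ,0}) + f⁻¹(Θ_{ℂᵖ,0}))`. -/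
abbrev NormalSpace (f : MapGerm n p) : Type :=
  (Fin p → O n) ⧸ (LinearMap.range f.tf ⊔ LinearMap.range f.ωf)

/-- The `𝒜ₑ`-codimension of `f`, as a cardinal number. -/
def AeCodim (f : MapGerm n p) : Cardinal := Module.rank ℂ f.NormalSpace

end MapGerm

/-- The Jacobian ideal `J_h ⊆ 𝒪_{ℂᵖ,0}`, generated by the partial derivatives of `h`. -/
def jacobianIdeal {p : ℕ} (h : O p) : Ideal (O p) :=
  Ideal.span (Set.range fun j : Fin p => pderiv j h)

namespace MapGerm

variable {n p : ℕ}

/-- The ideal `(f^*J_h) 𝒪_{ℂⁿ,0}` of `𝒪_{ℂⁿ,0}` generated by `f^*(J_h)`. -/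
def JO (f : MapGerm n p) (h : O p) : Ideal f.PushForward :=
  (jacobianIdeal h).map (algebraMap (O p) f.PushForward)

/-- `(f^*J_h) 𝒪_{ℂⁿ,0}` as an `𝒪_{ℂᵖ,0}`-module. -/
def JOn (f : MapGerm n p) (h : O p) : Submodule (O p) f.PushForward :=
  (f.JO h).restrictScalars (O p)

/-- `J_h 𝒪_{X,0}`, the ideal generated by `J_h` in `𝒪_{X,0} = f^* 𝒪_{ℂᵖ,0} ⊆ 𝒪_{ℂⁿ,0}`. Since
`𝒪_{ℂᵖ,0} → 𝒪_{X,0}` is onto, it is just the set of all `f^* g` with `g ∈ J_h`. -/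
def JOX (f : MapGerm n p) (h : O p) : Submodule (O p) f.PushForward :=
  Submodule.map (Algebra.linearMap (O p) f.PushForward) (jacobianIdeal h)

/-- `N_f = J_h 𝒪_{ℂⁿ,0} / J_h 𝒪_{X,0}`. -/
abbrev N (f : MapGerm n p) (h : O p) : Type :=
  f.JOn h ⧸ (f.JOX h).submoduleOf (f.JOn h)

/-- The ideal `(f^*)⁻¹((f^*J_h) 𝒪_{ℂⁿ,0})` of `𝒪_{ℂᵖ,0}`. -/
def preJO (f : MapGerm n p) (h : O p) : Ideal (O p) :=
  (f.JO h).comap (algebraMap (O p) f.PushForward)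

/-- `(f^*)⁻¹((f^*J_h) 𝒪_{ℂⁿ,0}) / J_h 𝒪_{ℂᵖ,0}`. -/
abbrev M (f : MapGerm n p) (h : O p) : Type :=
  f.preJO h ⧸ Submodule.submoduleOf (jacobianIdeal h) (f.preJO h)

theorem JOX_le_JOn (f : MapGerm n p) (h : O p) : f.JOX h ≤ f.JOn h := by
  rintro _ ⟨g, hg, rfl⟩
  exact Ideal.mem_map_of_mem _ hg

theorem jacobianIdeal_le_preJO (f : MapGerm n p) (h : O p) : jacobianIdeal h ≤ f.preJO h :=
  Ideal.le_comap_map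

/-- The map `(f^*)⁻¹((f^*J_h) 𝒪_{ℂⁿ,0}) → (f^*J_h) 𝒪_{ℂⁿ,0}`, `g ↦ f^* g`. -/
def preJOToJOn (f : MapGerm n p) (h : O p) : f.preJO h →ₗ[O p] f.JOn h :=
  (Algebra.linearMap (O p) f.PushForward).restrict (fun _ hg => hg)

/-- The `𝒪_{ℂᵖ,0}`-linear map from `(f^*)⁻¹((f^*J_h) 𝒪_{ℂⁿ,0}) / J_h 𝒪_{ℂᵖ,0}` to `N_f` induced
by `f^*`, i.e. `[g] ↦ [f^* g]`. -/
def MToN (f : MapGerm n p) (h : O p) : f.M h →ₗ[O p] f.N h :=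
  Submodule.mapQ _ _ (f.preJOToJOn h) (fun g hg => ⟨g, hg, rfl⟩)

end MapGerm

end MondGerm

end

noncomputable section

namespace MondGerm

/-! ### Germs, order of vanishing and Taylor truncation -/

section

variable {n : ℕ}

/-! The weights reduce most questions about germs to polynomials. Taylor series split into weighted
homogeneous parts (`wcomp`), and `f^*` respects the splitting (`wcomp_pullback`). The lowest part
`H` of `h` is killed by `f^*`, so it is divisible by `h`, and the quotient is a unit
(`exists_equation`). Euler's identity for `H` then gives `h ∈ J_h`.

Isomorphism `M ≅ N_f`. Injectivity: if `f^*g = f^*g'` with `g' ∈ J_h`, then `g - g' ∈ (h) ⊆ J_h`.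
Surjectivity: `J_h` lies in the conductor, i.e. `f^*(∂_j h) · 𝒪_n ⊆ f^*𝒪_{n+1}`, so every element of
`(f^*J_h)𝒪_n` is a pull-back. For polynomials the conductor statement is Dedekind's: in general
linear coordinates `H` is, up to a scalar, a monic polynomial `F` in one variable over a polynomial
ring `A`. The dual of `A[x]` under the trace form is `A[x]/F'(x)`, and it contains every birational
integral extension of `A[x]`, since traces of integral elements lie in `A`. Thus `F'(x)`, a
derivative of `H` in a general direction, conducts; such directions span (`exists_map_pderiv_mul`).
The statement passes to germs because polynomials generate `𝒪_n` over `𝒪_{n+1}`, by Nakayama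
(`span_range_ofPoly`).

Dimension formula. Put `c_j = f^*(∂_j h)`. Pairing with `c` maps `𝒪_n^{n+1}` onto `N_f`; the kernel
is `tf + ωf` as soon as every `v` with `c · v = 0` lies in the image of `df`. Now `c ≠ 0` and `c ·
df = 0` by the chain rule, so Cramer's rule gives `D_l v = df(η_l)` for each maximal minor `D_l`.
Some minor `D_{l₀}` is nonzero, so `df` is injective and `D_l η_{l₀} = D_{l₀} η_l`. A common prime
factor of the minors would put the ramification ideal inside a prime of height at most one; hence
there is none and `D_{l₀}` divides `η_{l₀}` (`mem_range_mulVec`). This division takes place in the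
polynomial ring, one weighted degree at a time; `ofPoly_dvd_of_dvd_wcomp` shows that the resulting
quotient series converges. -/

theorem O.exists_mk (g : O n) : ∃ F, ∃ hF : AnalyticAt ℂ F 0, g = O.mk F hF := by
  obtain ⟨_, F, hF, rfl⟩ := g
  exact ⟨F, hF, rfl⟩

theorem O.mk_eq_mk {F G : (Fin n → ℂ) → ℂ} {hF : AnalyticAt ℂ F 0} {hG : AnalyticAt ℂ G 0} :
    O.mk F hF = O.mk G hG ↔ F =ᶠ[𝓝 0] G := by
  rw [← Germ.coe_eq]
  exact Subtype.ext_iff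

theorem O.mk_mul {F G : (Fin n → ℂ) → ℂ} (hF : AnalyticAt ℂ F 0) (hG : AnalyticAt ℂ G 0) :
    O.mk F hF * O.mk G hG = O.mk (fun x => F x * G x) (hF.mul hG) := rfl

theorem O.mk_add {F G : (Fin n → ℂ) → ℂ} (hF : AnalyticAt ℂ F 0) (hG : AnalyticAt ℂ G 0) :
    O.mk F hF + O.mk G hG = O.mk (fun x => F x + G x) (hF.add hG) := rfl

theorem O.mk_sub {F G : (Fin n → ℂ) → ℂ} (hF : AnalyticAt ℂ F 0) (hG : AnalyticAt ℂ G 0) :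
    O.mk F hF - O.mk G hG = O.mk (fun x => F x - G x) (hF.sub hG) := rfl

theorem O.mk_sum {ι : Type*} (s : Finset ι) {F : ι → (Fin n → ℂ) → ℂ}
    (hF : ∀ i, AnalyticAt ℂ (F i) 0) :
    ∑ i ∈ s, O.mk (F i) (hF i) =
      O.mk (fun x => ∑ i ∈ s, F i x) (Finset.analyticAt_fun_sum _ fun i _ => hF i) := by
  classical
  induction s using Finset.induction_on with
  | empty => rfl
  | insert i s hi ih =>
    rw [Finset.sum_insert hi, ih, O.mk_add, O.mk_eq_mk]
    simp [Finset.sum_insert hi]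

theorem O.zero_eq_mk : (0 : O n) = O.mk (fun _ => 0) analyticAt_const := rfl

theorem O.algebraMap_eq_mk (c : ℂ) :
    algebraMap ℂ (O n) c = O.mk (fun _ => c) analyticAt_const := by
  apply Subtype.ext
  change algebraMap ℂ (Germ (𝓝 (0 : Fin n → ℂ)) ℂ) c = _
  rw [Algebra.algebraMap_eq_smul_one]
  refine congrArg Germ.ofFun (?_ : c • (1 : (Fin n → ℂ) → ℂ) = fun _ => c)
  ext x
  simp

theorem analyticAt_apply (i : Fin n) (y : Fin n → ℂ) : AnalyticAt ℂ (fun x : Fin n → ℂ => x i) y :=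
  (ContinuousLinearMap.proj (R := ℂ) (φ := fun _ : Fin n => ℂ) i).analyticAt y

/-- The germ of the coordinate function `x_i`. -/
def coord (i : Fin n) : O n := O.mk (fun x => x i) (analyticAt_apply i 0)

theorem analyticAt_eval (P : MvPolynomial (Fin n) ℂ) (x : Fin n → ℂ) :
    AnalyticAt ℂ (fun x => MvPolynomial.eval x P) x :=
  AnalyticOnNhd.eval_mvPolynomial P x (Set.mem_univ _)

/-- The germ of a polynomial. -/
def ofPoly : MvPolynomial (Fin n) ℂ →ₐ[ℂ] O n := MvPolynomial.aeval coord

theorem ofPoly_eq_mk (P : MvPolynomial (Fin n) ℂ) :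
    ofPoly P = O.mk (fun x => MvPolynomial.eval x P) (analyticAt_eval P 0) := by
  induction P using MvPolynomial.induction_on with
  | C c =>
    rw [ofPoly, MvPolynomial.aeval_C, O.algebraMap_eq_mk]
    simp
  | add p q hp hq =>
    rw [map_add, hp, hq, O.mk_add]
    simp
  | mul_X p i hp =>
    rw [map_mul, hp, ofPoly, MvPolynomial.aeval_X, coord, O.mk_mul]
    simp

@[simp] theorem ofPoly_X (i : Fin n) : ofPoly (MvPolynomial.X i) = coord i :=
  MvPolynomial.aeval_X _ _

/-- The ideal of germs that are `O(‖x‖ ^ N)` at the origin. -/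
def vanish (n N : ℕ) : Ideal (O n) where
  carrier := {g | ∃ F, ∃ hF : AnalyticAt ℂ F 0, g = O.mk F hF ∧ F =O[𝓝 0] fun x => ‖x‖ ^ N}
  zero_mem' := ⟨_, analyticAt_const, O.zero_eq_mk, Asymptotics.isBigO_zero _ _⟩
  add_mem' := by
    rintro _ _ ⟨F, hF, rfl, hF'⟩ ⟨G, hG, rfl, hG'⟩
    exact ⟨_, _, O.mk_add hF hG, hF'.add hG'⟩
  smul_mem' := by
    rintro g _ ⟨F, hF, rfl, hF'⟩
    obtain ⟨G, hG, rfl⟩ := O.exists_mk g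
    refine ⟨_, _, O.mk_mul hG hF, ?_⟩
    simpa using (hG.continuousAt.norm.isBoundedUnder_le.isBigO_one ℝ).mul hF'

theorem mk_mem_vanish {N : ℕ} {F : (Fin n → ℂ) → ℂ} {hF : AnalyticAt ℂ F 0} :
    O.mk F hF ∈ vanish n N ↔ F =O[𝓝 0] fun x => ‖x‖ ^ N := by
  refine ⟨?_, fun h => ⟨F, hF, rfl, h⟩⟩
  rintro ⟨G, hG, h, hG'⟩
  exact (O.mk_eq_mk.1 h).trans_isBigO hG'

theorem vanish_anti {N M : ℕ} (h : N ≤ M) : vanish n M ≤ vanish n N := by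
  rintro _ ⟨F, hF, rfl, hF'⟩
  refine mk_mem_vanish.2 (hF'.trans ?_)
  refine Asymptotics.IsBigO.of_bound 1 ?_
  have : ∀ᶠ x in 𝓝 (0 : Fin n → ℂ), ‖x‖ < 1 := by
    filter_upwards [Metric.ball_mem_nhds (0 : Fin n → ℂ) one_pos] with x hx
    simpa using hx
  filter_upwards [this] with x hx
  simpa using pow_le_pow_of_le_one (norm_nonneg x) hx.le h

theorem mul_mem_vanish {N M : ℕ} {g g' : O n} (h : g ∈ vanish n N) (h' : g' ∈ vanish n M) :
    g * g' ∈ vanish n (N + M) := by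
  obtain ⟨F, hF, rfl, hF'⟩ := h
  obtain ⟨G, hG, rfl, hG'⟩ := h'
  rw [O.mk_mul, mk_mem_vanish]
  simpa [pow_add] using hF'.mul hG'

theorem vanish_zero : vanish n 0 = ⊤ := by
  rw [Ideal.eq_top_iff_one]
  refine ⟨fun _ => 1, analyticAt_const, rfl, ?_⟩
  simpa using Asymptotics.isBigO_const_const (1 : ℂ) (one_ne_zero (α := ℝ)) (𝓝 (0 : Fin n → ℂ))

theorem pow_mem_vanish {g : O n} (h : g ∈ vanish n 1) (N : ℕ) : g ^ N ∈ vanish n N := by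
  induction N with
  | zero => rw [vanish_zero]; trivial
  | succ k ih => rw [pow_succ]; exact mul_mem_vanish ih h

theorem coord_mem_vanish (i : Fin n) : coord i ∈ vanish n 1 := by
  rw [coord, mk_mem_vanish]
  refine Asymptotics.IsBigO.of_bound 1 (Eventually.of_forall fun x => ?_)
  simpa using norm_le_pi_norm x i

theorem mem_vanish_one {F : (Fin n → ℂ) → ℂ} {hF : AnalyticAt ℂ F 0} :
    O.mk F hF ∈ vanish n 1 ↔ F 0 = 0 := by
  rw [mk_mem_vanish]
  constructor
  · intro h
    have := h.eq_zero_imp.self_of_nhds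
    simpa using this
  · intro h
    have := hF.differentiableAt.isBigO_sub
    simpa [h] using this.norm_right

theorem isUnit_of_notMem_vanish {g : O n} (hg : g ∉ vanish n 1) : IsUnit g := by
  obtain ⟨F, hF, rfl⟩ := O.exists_mk g
  rw [mem_vanish_one] at hg
  refine IsUnit.of_mul_eq_one (O.mk _ (hF.inv hg)) ?_
  rw [O.mk_mul]
  change _ = O.mk (fun _ => 1) analyticAt_const
  rw [O.mk_eq_mk]
  filter_upwards [hF.continuousAt.eventually_ne hg] with x hx
  simp [hx]

theorem one_notMem_vanish_one : (1 : O n) ∉ vanish n 1 := by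
  change O.mk (fun _ => 1) analyticAt_const ∉ _
  simp [mem_vanish_one]

instance : Nontrivial (O n) :=
  ⟨⟨1, 0, fun h => one_notMem_vanish_one (h ▸ (vanish n 1).zero_mem)⟩⟩

theorem monomial_mem_vanish (a : Fin n →₀ ℕ) (c : ℂ) :
    ofPoly (MvPolynomial.monomial a c) ∈ vanish n a.degree := by
  rw [MvPolynomial.monomial_eq, map_mul, Finsupp.degree_apply]
  refine Ideal.mul_mem_left _ _ ?_
  rw [Finsupp.prod, map_prod]
  refine Finset.induction_on a.support (by simp [vanish_zero]) fun i s hi h => ?_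
  rw [Finset.prod_insert hi, Finset.sum_insert hi]
  refine mul_mem_vanish ?_ h
  rw [map_pow, ofPoly_X]
  exact pow_mem_vanish (coord_mem_vanish i) _

theorem ofPoly_mem_vanish {P : MvPolynomial (Fin n) ℂ} {N : ℕ}
    (h : ∀ a, a.degree < N → P.coeff a = 0) : ofPoly P ∈ vanish n N := by
  rw [P.as_sum, map_sum]
  refine Ideal.sum_mem _ fun a ha => ?_
  refine vanish_anti ?_ (monomial_mem_vanish a _)
  by_contra hlt
  exact MvPolynomial.mem_support_iff.1 ha (h a (not_le.1 hlt))

theorem eq_zero_of_isBigO {x : ℂ} {r : ℕ} (h : (fun t : ℂ => t ^ r * x) =O[𝓝 0] fun t => t ^ (r + 1)) :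
    x = 0 := by
  have h1 : (fun _ : ℂ => x) =O[𝓝[≠] 0] fun t : ℂ => t := by
    refine ((Asymptotics.isBigO_refl (fun t : ℂ => (t ^ r)⁻¹) (𝓝[≠] 0)).mul
      (h.mono nhdsWithin_le_nhds)).congr' ?_ ?_
    · filter_upwards [self_mem_nhdsWithin] with t ht
      field_simp [show t ≠ 0 from ht]
    · filter_upwards [self_mem_nhdsWithin] with t ht
      rw [pow_succ, inv_mul_cancel_left₀ (pow_ne_zero _ ht)]
  have h2 : Tendsto (fun _ : ℂ => x) (𝓝[≠] 0) (𝓝 0) :=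
    h1.trans_tendsto (tendsto_id.mono_left nhdsWithin_le_nhds)
  exact tendsto_nhds_unique tendsto_const_nhds h2

theorem eval_weighted_smul {w : Fin n → ℕ} {P : MvPolynomial (Fin n) ℂ} {k : ℕ}
    (hP : P.IsWeightedHomogeneous w k) (t : ℂ) (x : Fin n → ℂ) :
    MvPolynomial.eval (fun i => t ^ w i * x i) P = t ^ k * MvPolynomial.eval x P := by
  rw [MvPolynomial.eval_eq', MvPolynomial.eval_eq', Finset.mul_sum]
  refine Finset.sum_congr rfl fun a ha => ?_
  have : t ^ k = ∏ i, t ^ (w i * a i) := by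
    rw [← hP (MvPolynomial.mem_support_iff.1 ha), Finset.prod_pow_eq_pow_sum, Finsupp.weight_apply,
      Finsupp.sum_fintype _ _ (by simp)]
    simp [mul_comm]
  simp only [mul_pow, Finset.prod_mul_distrib, this, ← pow_mul]
  ring

/-- Induction on the degree `k`: the lower components being zero, the component of degree `k`
differs from `P` by terms of order `k + 1`. On a line `t ↦ t • x` it equals `t ^ k` times a constant
and is `O(t ^ (k + 1))`, so the constant is zero. -/
theorem coeff_eq_zero_of_mem_vanish {P : MvPolynomial (Fin n) ℂ} {N : ℕ}
    (h : ofPoly P ∈ vanish n N) (a : Fin n →₀ ℕ) (ha : a.degree < N) : P.coeff a = 0 := by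
  suffices ∀ k < N, MvPolynomial.homogeneousComponent k P = 0 by
    have := congrArg (MvPolynomial.coeff a) (this _ ha)
    simpa [MvPolynomial.coeff_homogeneousComponent] using this
  intro k
  induction k using Nat.strong_induction_on with
  | _ k ih =>
    intro hk
    set Q := P - MvPolynomial.homogeneousComponent k P with hQ
    have hQv : ofPoly Q ∈ vanish n (k + 1) := by
      refine ofPoly_mem_vanish fun b hb => ?_
      rw [hQ, MvPolynomial.coeff_sub, MvPolynomial.coeff_homogeneousComponent]
      split_ifs with hbk
      · simp
      · have := congrArg (MvPolynomial.coeff b) (ih b.degree (by omega) (by omega))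
        simpa [MvPolynomial.coeff_homogeneousComponent] using this
    have hv : ofPoly (MvPolynomial.homogeneousComponent k P) ∈ vanish n (k + 1) := by
      have : MvPolynomial.homogeneousComponent k P = P - Q := by simp [hQ]
      rw [this, map_sub]
      exact Ideal.sub_mem _ (vanish_anti hk h) hQv
    rw [ofPoly_eq_mk, mk_mem_vanish] at hv
    refine MvPolynomial.funext fun x => ?_
    rw [map_zero]
    refine eq_zero_of_isBigO (r := k) ?_
    have ht : Tendsto (fun t : ℂ => t • x) (𝓝 0) (𝓝 0) := by
      have : Continuous fun t : ℂ => t • x := by fun_prop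
      simpa using this.tendsto 0
    have h1 := hv.comp_tendsto ht
    refine (h1.congr_left fun t => ?_).trans ?_
    · have := eval_weighted_smul (MvPolynomial.homogeneousComponent_isHomogeneous k P) t x
      simpa [Pi.smul_def] using this
    · refine Asymptotics.IsBigO.of_bound (‖x‖ ^ (k + 1)) (Eventually.of_forall fun t => ?_)
      simp [norm_smul, mul_pow, mul_comm]

/-- The polynomial `x ↦ p_k (x, …, x)` for the term `p_k` of a formal multilinear series. -/
def seriesPoly (p : FormalMultilinearSeries ℂ (Fin n → ℂ) ℂ) (k : ℕ) : MvPolynomial (Fin n) ℂ :=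
  ∑ v : Fin k → Fin n,
    MvPolynomial.C (p k fun l => Pi.single (v l) 1) * ∏ l, MvPolynomial.X (v l)

theorem eval_seriesPoly (p : FormalMultilinearSeries ℂ (Fin n → ℂ) ℂ) (k : ℕ) (x : Fin n → ℂ) :
    MvPolynomial.eval x (seriesPoly p k) = p k fun _ => x := by
  conv_rhs => rw [pi_eq_sum_univ' x]
  rw [ContinuousMultilinearMap.map_sum, seriesPoly, map_sum]
  refine Finset.sum_congr rfl fun v _ => ?_
  rw [ContinuousMultilinearMap.map_smul_univ]
  simp only [map_mul, MvPolynomial.eval_C, map_prod, MvPolynomial.eval_X, smul_eq_mul]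
  rw [mul_comm]

theorem seriesPoly_isHomogeneous (p : FormalMultilinearSeries ℂ (Fin n → ℂ) ℂ) (k : ℕ) :
    (seriesPoly p k).IsHomogeneous k := by
  refine MvPolynomial.IsHomogeneous.sum _ _ _ fun v _ => ?_
  have h := MvPolynomial.IsHomogeneous.prod Finset.univ
    (fun l => (MvPolynomial.X (v l) : MvPolynomial (Fin n) ℂ)) (fun _ => 1)
    fun l _ => MvPolynomial.isHomogeneous_X ℂ (v l)
  simpa using h.C_mul (p k fun l => Pi.single (v l) 1)

theorem mk_sub_ofPoly_mem_vanish {F : (Fin n → ℂ) → ℂ} (hF : AnalyticAt ℂ F 0)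
    {p : FormalMultilinearSeries ℂ (Fin n → ℂ) ℂ} (hp : HasFPowerSeriesAt F p 0) (N : ℕ) :
    O.mk F hF - ofPoly (∑ k ∈ Finset.range N, seriesPoly p k) ∈ vanish n N := by
  rw [ofPoly_eq_mk, O.mk_sub, mk_mem_vanish]
  simpa [eval_seriesPoly, FormalMultilinearSeries.partialSum] using
    hp.isBigO_sub_partialSum_pow N

theorem exists_truncation (g : O n) (N : ℕ) :
    ∃ P : MvPolynomial (Fin n) ℂ, g - ofPoly P ∈ vanish n N := by
  obtain ⟨F, hF, rfl⟩ := O.exists_mk g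
  obtain ⟨p, hp⟩ := id hF
  exact ⟨_, mk_sub_ofPoly_mem_vanish hF hp N⟩

/-- The Krull intersection property: vanishing to order `k + 1` kills all Taylor coefficients of
degree at most `k`, and a convergent series is determined by its coefficients. -/
theorem eq_zero_of_mem_vanish {g : O n} (h : ∀ N, g ∈ vanish n N) : g = 0 := by
  obtain ⟨F, hF, rfl⟩ := O.exists_mk g
  obtain ⟨p, hp⟩ := id hF
  rw [O.zero_eq_mk, O.mk_eq_mk]
  have hz : ∀ k (x : Fin n → ℂ), (p k fun _ => x) = 0 := by
    intro k x
    have hsum : ofPoly (∑ j ∈ Finset.range (k + 1), seriesPoly p j) ∈ vanish n (k + 1) := by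
      have := Ideal.sub_mem _ (h (k + 1)) (mk_sub_ofPoly_mem_vanish hF hp (k + 1))
      simpa using this
    have hk : seriesPoly p k = 0 := by
      ext a
      rw [MvPolynomial.coeff_zero]
      by_cases ha : a.degree = k
      · have := coeff_eq_zero_of_mem_vanish hsum a (by omega)
        rw [MvPolynomial.coeff_sum, Finset.sum_eq_single k] at this
        · exact this
        · intro j _ hj
          exact (seriesPoly_isHomogeneous p j).coeff_eq_zero (by omega)
        · simp
      · exact (seriesPoly_isHomogeneous p k).coeff_eq_zero ha
    rw [← eval_seriesPoly, hk, map_zero]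
  filter_upwards [hp.eventually_hasSum] with x hx
  simp only [hz, zero_add] at hx
  exact hx.unique hasSum_zero

/-- Hadamard's lemma. When `F 0 = 0`, shifting the power series by one writes `F x` as a linear
form, analytic in `x`, applied to `x` itself; its values on the basis vectors are the coefficients.
-/
theorem exists_sum_coord {g : O n} (hg : g ∈ vanish n 1) :
    g ∈ Ideal.span (Set.range (coord : Fin n → O n)) := by
  obtain ⟨F, hF, rfl⟩ := O.exists_mk g
  obtain ⟨p, r, hp⟩ := id hF
  rw [mem_vanish_one] at hg
  have hpos : 0 < p.shift.radius := by
    rw [FormalMultilinearSeries.radius_shift]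
    exact hp.r_pos.trans_le hp.r_le
  have hG := p.shift.hasFPowerSeriesOnBall hpos
  have hG' : AnalyticAt ℂ p.shift.sum 0 := hG.analyticAt
  have hGi : ∀ i : Fin n, AnalyticAt ℂ (fun x => p.shift.sum x (Pi.single i 1)) 0 := fun i =>
    ((ContinuousLinearMap.apply ℂ ℂ (Pi.single i 1 : Fin n → ℂ)).analyticAt _).comp hG'
  have : O.mk F hF = ∑ i, O.mk _ (hGi i) * coord i := by
    have hmk : ∑ i, O.mk _ (hGi i) * coord i = O.mk (fun x => ∑ i, p.shift.sum x (Pi.single i 1) * x i)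
        (Finset.analyticAt_fun_sum _ fun i _ => (hGi i).mul (analyticAt_apply i 0)) := by
      exact O.mk_sum Finset.univ fun i => (hGi i).mul (analyticAt_apply i 0)
    rw [hmk, O.mk_eq_mk]
    filter_upwards [hp.hasFPowerSeriesAt.eventually_hasSum,
      hG.hasFPowerSeriesAt.eventually_hasSum] with x hx hx'
    rw [zero_add] at hx hx'
    have h1 : HasSum (fun k => p (k + 1) fun _ => x) (p.shift.sum x x) := by
      have hk : ∀ k, (p (k + 1) fun _ => x) = p.shift k (fun _ => x) x := by
        intro k
        change _ = (p (k + 1)).curryRight (fun _ => x) x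
        rw [ContinuousMultilinearMap.curryRight_apply]
        congr 1
        ext l
        refine Fin.lastCases ?_ (fun j => ?_) l <;> simp
      simp only [hk]
      exact hx'.mapL (ContinuousLinearMap.apply ℂ ℂ x)
    rw [← hasSum_nat_add_iff' 1] at hx
    have h2 := hx.unique h1
    have h0 : (p 0 fun _ => x) = 0 := by
      rw [← hg]
      exact hp.coeff_zero _
    simp only [Finset.range_one, Finset.sum_singleton, h0, sub_zero] at h2
    rw [h2]
    generalize p.shift.sum x = T
    conv_lhs => rw [pi_eq_sum_univ' x]
    simp [mul_comm]
  rw [this]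
  exact Ideal.sum_mem _ fun i _ => Ideal.mul_mem_left _ _ (Ideal.subset_span ⟨i, rfl⟩)

end

/-! ### Weighted homogeneous components of germs -/

section

variable {n : ℕ}

/-- The part of weighted degree `k` of the Taylor series of a germ (for positive weights). -/
def wcomp (w : Fin n → ℕ) (k : ℕ) (g : O n) : MvPolynomial (Fin n) ℂ :=
  MvPolynomial.weightedHomogeneousComponent w k (exists_truncation g (k + 1)).choose

/-- Because of this inequality a truncation to order `k + 1` retains every monomial of weighted
degree `k`, so `wcomp` does not depend on the truncation chosen (`wcomp_eq`). -/
theorem degree_le_weight {w : Fin n → ℕ} (hw : ∀ i, 0 < w i) (a : Fin n →₀ ℕ) :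
    a.degree ≤ Finsupp.weight w a := by
  rw [Finsupp.weight_apply, Finsupp.sum_fintype _ _ (by simp), Finsupp.degree_eq_sum]
  exact Finset.sum_le_sum fun i _ => by simpa using Nat.le_mul_of_pos_right _ (hw i)

theorem weightedHomogeneousComponent_eq_zero_of_vanish {w : Fin n → ℕ} (hw : ∀ i, 0 < w i) {P : MvPolynomial (Fin n) ℂ} {k N : ℕ}
    (hk : k < N) (h : ofPoly P ∈ vanish n N) :
    MvPolynomial.weightedHomogeneousComponent w k P = 0 := by
  classical
  ext a
  rw [MvPolynomial.coeff_weightedHomogeneousComponent, MvPolynomial.coeff_zero]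
  split_ifs with ha
  · exact coeff_eq_zero_of_mem_vanish h a (by have := degree_le_weight hw a; omega)
  · rfl

theorem wcomp_eq {w : Fin n → ℕ} (hw : ∀ i, 0 < w i) {g : O n} {P : MvPolynomial (Fin n) ℂ} {k N : ℕ} (hk : k < N)
    (h : g - ofPoly P ∈ vanish n N) :
    wcomp w k g = MvPolynomial.weightedHomogeneousComponent w k P := by
  rw [← sub_eq_zero, wcomp, ← map_sub]
  refine weightedHomogeneousComponent_eq_zero_of_vanish hw (Nat.lt_succ_self k) ?_
  rw [map_sub]
  have h1 := (exists_truncation g (k + 1)).choose_spec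
  have := Ideal.sub_mem _ (vanish_anti hk h) h1
  simpa using this

theorem wcomp_add {w : Fin n → ℕ} (hw : ∀ i, 0 < w i) (k : ℕ) (g g' : O n) : wcomp w k (g + g') = wcomp w k g + wcomp w k g' := by
  obtain ⟨P, hP⟩ := exists_truncation g (k + 1)
  obtain ⟨P', hP'⟩ := exists_truncation g' (k + 1)
  rw [wcomp_eq hw k.lt_succ_self hP, wcomp_eq hw k.lt_succ_self hP', ← map_add]
  refine wcomp_eq hw k.lt_succ_self ?_
  rw [map_add, add_sub_add_comm]
  exact Ideal.add_mem _ hP hP'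

theorem wcomp_ofPoly {w : Fin n → ℕ} (hw : ∀ i, 0 < w i) (k : ℕ) (P : MvPolynomial (Fin n) ℂ) :
    wcomp w k (ofPoly P) = MvPolynomial.weightedHomogeneousComponent w k P :=
  wcomp_eq hw k.lt_succ_self (by simp)

theorem wcomp_zero {w : Fin n → ℕ} (hw : ∀ i, 0 < w i) (k : ℕ) : wcomp w k (0 : O n) = 0 := by
  simpa using wcomp_ofPoly hw k 0

theorem wcomp_sum {w : Fin n → ℕ} (hw : ∀ i, 0 < w i) {ι : Type*} (s : Finset ι) (g : ι → O n) (k : ℕ) :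
    wcomp w k (∑ i ∈ s, g i) = ∑ i ∈ s, wcomp w k (g i) :=
  map_sum (AddMonoidHom.mk' (wcomp w k) (wcomp_add hw k)) g s

theorem wcomp_isWeightedHomogeneous (w : Fin n → ℕ) (k : ℕ) (g : O n) :
    (wcomp w k g).IsWeightedHomogeneous w k :=
  MvPolynomial.weightedHomogeneousComponent_isWeightedHomogeneous (R := ℂ) k _

theorem weightedHomogeneousComponent_mul (w : Fin n → ℕ) (k : ℕ) (P Q : MvPolynomial (Fin n) ℂ) :
    MvPolynomial.weightedHomogeneousComponent w k (P * Q) =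
      ∑ ij ∈ Finset.HasAntidiagonal.antidiagonal k, MvPolynomial.weightedHomogeneousComponent w ij.1 P *
        MvPolynomial.weightedHomogeneousComponent w ij.2 Q := by
  classical
  ext c
  rw [MvPolynomial.coeff_weightedHomogeneousComponent, MvPolynomial.coeff_sum]
  simp only [MvPolynomial.coeff_mul, MvPolynomial.coeff_weightedHomogeneousComponent]
  rw [Finset.sum_comm]
  split_ifs with hc
  · refine Finset.sum_congr rfl fun ab hab => ?_
    rw [Finset.sum_eq_single (Finsupp.weight w ab.1, Finsupp.weight w ab.2)]
    · simp
    · rintro ⟨i, j⟩ _ hij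
      by_cases h1 : Finsupp.weight w ab.1 = i
      · have h2 : Finsupp.weight w ab.2 ≠ j := fun h2 => hij (by rw [h1, h2])
        simp [h2]
      · simp [h1]
    · intro h
      refine absurd ?_ h
      rw [Finset.HasAntidiagonal.mem_antidiagonal, ← map_add, Finset.HasAntidiagonal.mem_antidiagonal.1 hab, hc]
  · refine (Finset.sum_eq_zero fun ab hab => Finset.sum_eq_zero ?_).symm
    rintro ⟨i, j⟩ hij
    by_cases h1 : Finsupp.weight w ab.1 = i
    · have h2 : Finsupp.weight w ab.2 ≠ j := fun h2 => hc (by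
        rw [← Finset.HasAntidiagonal.mem_antidiagonal.1 hab, map_add, h1, h2, Finset.HasAntidiagonal.mem_antidiagonal.1 hij])
      simp [h2]
    · simp [h1]

theorem wcomp_mul {w : Fin n → ℕ} (hw : ∀ i, 0 < w i) (k : ℕ) (g g' : O n) :
    wcomp w k (g * g') = ∑ ij ∈ Finset.HasAntidiagonal.antidiagonal k, wcomp w ij.1 g * wcomp w ij.2 g' := by
  obtain ⟨P, hP⟩ := exists_truncation g (k + 1)
  obtain ⟨P', hP'⟩ := exists_truncation g' (k + 1)
  have : g * g' - ofPoly (P * P') ∈ vanish n (k + 1) := by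
    have e : g * g' - ofPoly (P * P') = g * (g' - ofPoly P') + (g - ofPoly P) * ofPoly P' := by
      rw [map_mul]; ring
    rw [e]
    exact Ideal.add_mem _ (Ideal.mul_mem_left _ _ hP') (Ideal.mul_mem_right _ _ hP)
  rw [wcomp_eq hw k.lt_succ_self this, weightedHomogeneousComponent_mul]
  refine Finset.sum_congr rfl fun ij hij => ?_
  have := Finset.HasAntidiagonal.mem_antidiagonal.1 hij
  rw [wcomp_eq hw (by omega) hP, wcomp_eq hw (by omega) hP']

theorem wcomp_ofPoly_mul {w : Fin n → ℕ} (hw : ∀ i, 0 < w i) {D : MvPolynomial (Fin n) ℂ} {e : ℕ} (hD : D.IsWeightedHomogeneous w e)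
    (k : ℕ) (g : O n) : wcomp w (e + k) (ofPoly D * g) = D * wcomp w k g := by
  rw [wcomp_mul hw, Finset.sum_eq_single (e, k)]
  · rw [wcomp_ofPoly hw, hD.weightedHomogeneousComponent_same]
  · rintro ⟨i, j⟩ hij hne
    rw [Finset.HasAntidiagonal.mem_antidiagonal] at hij
    rw [wcomp_ofPoly hw, hD.weightedHomogeneousComponent_ne, zero_mul]
    rintro rfl
    exact hne (by simp only [Prod.mk.injEq, true_and]; simp only at hij; omega)
  · simp

theorem wcomp_ofPoly_mul_of_lt {w : Fin n → ℕ} (hw : ∀ i, 0 < w i) {D : MvPolynomial (Fin n) ℂ} {e : ℕ}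
    (hD : D.IsWeightedHomogeneous w e) {k : ℕ} (hk : k < e) (g : O n) :
    wcomp w k (ofPoly D * g) = 0 := by
  rw [wcomp_mul hw]
  refine Finset.sum_eq_zero fun ij hij => ?_
  rw [Finset.HasAntidiagonal.mem_antidiagonal] at hij
  rw [wcomp_ofPoly hw, hD.weightedHomogeneousComponent_ne _ (by omega), zero_mul]

/-- The comparison opposite to `degree_le_weight`: finitely many weighted components control all
Taylor coefficients of degree below `N`. It is what makes the components determine the germ. -/
theorem exists_degree_le_of_weight_bound (w : Fin n → ℕ) (N : ℕ) : ∃ K, ∀ a : Fin n →₀ ℕ, a.degree < N →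
    Finsupp.weight w a < K := by
  refine ⟨N * (∑ i, w i) + 1, fun a ha => Nat.lt_succ_of_le ?_⟩
  rw [Finsupp.weight_apply, Finsupp.sum_fintype _ _ (by simp), Finset.mul_sum]
  refine Finset.sum_le_sum fun i _ => ?_
  rw [smul_eq_mul]
  exact Nat.mul_le_mul_right _ ((Finsupp.le_degree i a).trans ha.le)

theorem eq_zero_of_wcomp {w : Fin n → ℕ} (hw : ∀ i, 0 < w i) {g : O n} (h : ∀ k, wcomp w k g = 0) : g = 0 := by
  classical
  refine eq_zero_of_mem_vanish fun N => ?_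
  obtain ⟨K, hK⟩ := exists_degree_le_of_weight_bound w N
  obtain ⟨P, hP⟩ := exists_truncation g (max N K)
  have h2 : ofPoly P ∈ vanish n N := by
    refine ofPoly_mem_vanish fun a ha => ?_
    have := congrArg (MvPolynomial.coeff a) (h (Finsupp.weight w a))
    rw [wcomp_eq hw (lt_max_of_lt_right (hK a ha)) hP,
      MvPolynomial.coeff_weightedHomogeneousComponent] at this
    simpa using this
  have := Ideal.add_mem _ (vanish_anti (le_max_left N K) hP) h2
  simpa using this

theorem eq_of_wcomp {w : Fin n → ℕ} (hw : ∀ i, 0 < w i) {g g' : O n} (h : ∀ k, wcomp w k g = wcomp w k g') : g = g' := by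
  rw [← sub_eq_zero]
  refine eq_zero_of_wcomp hw fun k => ?_
  have := wcomp_add hw k (g - g') g'
  rw [sub_add_cancel, h k] at this
  simpa using this

theorem ofPoly_wcomp_lowest {w : Fin n → ℕ} (hw : ∀ i, 0 < w i) {g : O n} (hg : g ≠ 0) :
    ∃ k, wcomp w k g ≠ 0 ∧ ∀ j < k, wcomp w j g = 0 := by
  classical
  have : ∃ k, wcomp w k g ≠ 0 := by
    by_contra! h
    exact hg (eq_zero_of_wcomp hw h)
  exact ⟨Nat.find this, Nat.find_spec this, fun j hj => not_not.1 (Nat.find_min this hj)⟩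

theorem ofPoly_injective : Function.Injective (ofPoly : MvPolynomial (Fin n) ℂ → O n) := by
  rw [injective_iff_map_eq_zero]
  intro P h
  ext a
  refine coeff_eq_zero_of_mem_vanish (N := a.degree + 1) ?_ a (Nat.lt_succ_self _)
  rw [h]
  exact Ideal.zero_mem _

instance : IsDomain (O n) := by
  have : NoZeroDivisors (O n) := by
    refine ⟨fun {g g'} h => ?_⟩
    by_contra! hne
    have hw : ∀ i : Fin n, 0 < (fun _ => 1 : Fin n → ℕ) i := fun _ => one_pos
    obtain ⟨k, hk, hk'⟩ := ofPoly_wcomp_lowest hw hne.1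
    obtain ⟨l, hl, hl'⟩ := ofPoly_wcomp_lowest hw hne.2
    -- In degree `k + l` only the product of the two lowest components survives, and it is nonzero
    -- in the polynomial ring.
    have := wcomp_mul hw (k + l) g g'
    rw [h, wcomp_zero hw, Finset.sum_eq_single (k, l)] at this
    · exact mul_ne_zero hk hl this.symm
    · rintro ⟨i, j⟩ hij hne
      rw [Finset.HasAntidiagonal.mem_antidiagonal] at hij
      simp only at hij
      rcases lt_trichotomy i k with h1 | h1 | h1
      · rw [hk' _ h1, zero_mul]
      · exact absurd (by rw [h1, show j = l by omega]) hne
      · rw [hl' j (by omega), mul_zero]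
    · simp
  exact NoZeroDivisors.to_isDomain _

end

/-! ### Convergence and division by weighted homogeneous polynomials -/

section

variable {n : ℕ}

/-- The value of the monomial with exponent `a` at the polyradius `ρ`. -/
def monomialNorm (ρ : Fin n → ℝ) (a : Fin n →₀ ℕ) : ℝ := ∏ i, ρ i ^ a i

theorem monomialNorm_add (ρ : Fin n → ℝ) (a b : Fin n →₀ ℕ) :
    monomialNorm ρ (a + b) = monomialNorm ρ a * monomialNorm ρ b := by
  simp [monomialNorm, pow_add, Finset.prod_mul_distrib]

theorem monomialNorm_nonneg {ρ : Fin n → ℝ} (hρ : ∀ i, 0 ≤ ρ i) (a : Fin n →₀ ℕ) :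
    0 ≤ monomialNorm ρ a := Finset.prod_nonneg fun i _ => pow_nonneg (hρ i) _

theorem monomialNorm_mono {ρ ρ' : Fin n → ℝ} (hρ : ∀ i, 0 ≤ ρ i) (h : ∀ i, ρ i ≤ ρ' i)
    (a : Fin n →₀ ℕ) : monomialNorm ρ a ≤ monomialNorm ρ' a :=
  Finset.prod_le_prod (fun i _ => pow_nonneg (hρ i) _) fun i _ => pow_le_pow_left₀ (hρ i) (h i) _

theorem monomialNorm_const (r : ℝ) (a : Fin n →₀ ℕ) :
    monomialNorm (fun _ => r) a = r ^ a.degree := by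
  rw [monomialNorm, Finset.prod_pow_eq_pow_sum, Finsupp.degree_eq_sum]

theorem monomialNorm_scale (w : Fin n → ℕ) (t : ℝ) (ρ : Fin n → ℝ) (a : Fin n →₀ ℕ) :
    monomialNorm (fun i => t ^ w i * ρ i) a = t ^ Finsupp.weight w a * monomialNorm ρ a := by
  simp only [monomialNorm, mul_pow, Finset.prod_mul_distrib, ← pow_mul]
  rw [Finset.prod_pow_eq_pow_sum, Finsupp.weight_apply, Finsupp.sum_fintype _ _ (by simp)]
  simp [mul_comm]

/-- The `ℓ¹`-norm of the coefficients of a polynomial, weighted by a polyradius. -/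
def l1Norm (ρ : Fin n → ℝ) (P : MvPolynomial (Fin n) ℂ) : ℝ :=
  ∑ a ∈ P.support, ‖P.coeff a‖ * monomialNorm ρ a

theorem l1Norm_eq_sum (ρ : Fin n → ℝ) {P : MvPolynomial (Fin n) ℂ} {s : Finset (Fin n →₀ ℕ)}
    (hs : P.support ⊆ s) : l1Norm ρ P = ∑ a ∈ s, ‖P.coeff a‖ * monomialNorm ρ a := by
  refine Finset.sum_subset hs fun a _ ha => ?_
  rw [MvPolynomial.notMem_support_iff.1 ha, norm_zero, zero_mul]

theorem l1Norm_nonneg {ρ : Fin n → ℝ} (hρ : ∀ i, 0 ≤ ρ i) (P : MvPolynomial (Fin n) ℂ) :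
    0 ≤ l1Norm ρ P :=
  Finset.sum_nonneg fun a _ => mul_nonneg (norm_nonneg _) (monomialNorm_nonneg hρ a)

theorem l1Norm_zero (ρ : Fin n → ℝ) : l1Norm ρ (0 : MvPolynomial (Fin n) ℂ) = 0 := by
  simp [l1Norm]

theorem l1Norm_add_le {ρ : Fin n → ℝ} (hρ : ∀ i, 0 ≤ ρ i) (P Q : MvPolynomial (Fin n) ℂ) :
    l1Norm ρ (P + Q) ≤ l1Norm ρ P + l1Norm ρ Q := by
  classical
  rw [l1Norm_eq_sum ρ (MvPolynomial.support_add (p := P) (q := Q)),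
    l1Norm_eq_sum ρ (Finset.subset_union_left (s₁ := P.support) (s₂ := Q.support)),
    l1Norm_eq_sum ρ (Finset.subset_union_right (s₁ := P.support) (s₂ := Q.support)),
    ← Finset.sum_add_distrib]
  refine Finset.sum_le_sum fun a _ => ?_
  rw [← add_mul, MvPolynomial.coeff_add]
  exact mul_le_mul_of_nonneg_right (norm_add_le _ _) (monomialNorm_nonneg hρ a)

theorem l1Norm_neg (ρ : Fin n → ℝ) (P : MvPolynomial (Fin n) ℂ) :
    l1Norm ρ (-P) = l1Norm ρ P := by
  simp [l1Norm, MvPolynomial.support_neg]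

theorem l1Norm_sum_le {ρ : Fin n → ℝ} (hρ : ∀ i, 0 ≤ ρ i) {ι : Type*} (s : Finset ι)
    (P : ι → MvPolynomial (Fin n) ℂ) : l1Norm ρ (∑ i ∈ s, P i) ≤ ∑ i ∈ s, l1Norm ρ (P i) := by
  classical
  induction s using Finset.induction_on with
  | empty => simp [l1Norm_zero]
  | insert i s hi ih =>
    rw [Finset.sum_insert hi, Finset.sum_insert hi]
    exact (l1Norm_add_le hρ _ _).trans (by gcongr)

theorem l1Norm_monomial_mul (ρ : Fin n → ℝ) (a : Fin n →₀ ℕ) (c : ℂ)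
    (Q : MvPolynomial (Fin n) ℂ) :
    l1Norm ρ (MvPolynomial.monomial a c * Q) = ‖c‖ * monomialNorm ρ a * l1Norm ρ Q := by
  classical
  have hs : (MvPolynomial.monomial a c * Q).support ⊆ Q.support.map (addLeftEmbedding a) := by
    intro b hb
    rw [Finset.mem_map]
    obtain ⟨x, hx, y, hy, rfl⟩ := Finset.mem_add.1 (MvPolynomial.support_mul _ _ hb)
    obtain rfl := Finset.mem_singleton.1 (MvPolynomial.support_monomial_subset hx)
    exact ⟨y, hy, rfl⟩
  rw [l1Norm_eq_sum ρ hs, Finset.sum_map, l1Norm, Finset.mul_sum]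
  refine Finset.sum_congr rfl fun b _ => ?_
  rw [addLeftEmbedding_apply, MvPolynomial.coeff_monomial_mul, norm_mul, monomialNorm_add]
  ring

theorem l1Norm_mul_le {ρ : Fin n → ℝ} (hρ : ∀ i, 0 ≤ ρ i) (P Q : MvPolynomial (Fin n) ℂ) :
    l1Norm ρ (P * Q) ≤ l1Norm ρ P * l1Norm ρ Q := by
  conv_lhs => rw [P.as_sum, Finset.sum_mul]
  refine (l1Norm_sum_le hρ _ _).trans ?_
  simp only [l1Norm_monomial_mul, ← Finset.sum_mul]
  rfl

theorem l1Norm_mono {ρ ρ' : Fin n → ℝ} (hρ : ∀ i, 0 ≤ ρ i) (h : ∀ i, ρ i ≤ ρ' i)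
    (P : MvPolynomial (Fin n) ℂ) : l1Norm ρ P ≤ l1Norm ρ' P :=
  Finset.sum_le_sum fun a _ => mul_le_mul_of_nonneg_left (monomialNorm_mono hρ h a) (norm_nonneg _)

theorem l1Norm_scale {w : Fin n → ℕ} {k : ℕ} {P : MvPolynomial (Fin n) ℂ}
    (hP : P.IsWeightedHomogeneous w k) (t : ℝ) (ρ : Fin n → ℝ) :
    l1Norm (fun i => t ^ w i * ρ i) P = t ^ k * l1Norm ρ P := by
  rw [l1Norm, l1Norm, Finset.mul_sum]
  refine Finset.sum_congr rfl fun a ha => ?_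
  rw [monomialNorm_scale, hP (MvPolynomial.mem_support_iff.1 ha)]
  ring

/-- A nonzero polynomial has a dominant monomial on a suitable polycircle. -/
theorem exists_dominant_monomial {D : MvPolynomial (Fin n) ℂ} (hD : D ≠ 0) :
    ∃ ρ : Fin n → ℝ, (∀ i, 0 < ρ i) ∧ ∃ a, 
      l1Norm ρ (D - MvPolynomial.monomial a (D.coeff a)) < ‖D.coeff a‖ * monomialNorm ρ a := by
  classical
  -- All exponents are digits in base `M`, so `e` is injective on the support. With `ρ i = s ^ M ^
  -- i` the monomial `a` has size `s ^ e a`, and for large `s` the monomial maximizing `e` outweighs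
  -- the sum of the others.
  set M := D.totalDegree + 1 with hM
  set e : (Fin n →₀ ℕ) → ℕ := fun a => ∑ i, a i * M ^ (i : ℕ) with he
  have hlt : ∀ a ∈ D.support, ∀ i, a i < M := fun a ha i => Nat.lt_succ_of_le
    (((Finsupp.le_degree i a).trans (MvPolynomial.le_totalDegree ha)))
  have hinj : ∀ a ∈ D.support, ∀ b ∈ D.support, e a = e b → a = b := by
    intro a ha b hb hab
    have : finFunctionFinEquiv (fun i => (⟨a i, hlt a ha i⟩ : Fin M)) =
        finFunctionFinEquiv (fun i => (⟨b i, hlt b hb i⟩ : Fin M)) := by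
      apply Fin.ext
      simpa [finFunctionFinEquiv_apply] using hab
    have := finFunctionFinEquiv.injective this
    ext i
    simpa using congrArg Fin.val (congrFun this i)
  obtain ⟨a, ha, hmax⟩ := Finset.exists_max_image D.support e
    (MvPolynomial.support_nonempty.2 hD)
  set C := ∑ b ∈ D.support, ‖D.coeff b‖ with hC
  have hapos : 0 < ‖D.coeff a‖ := norm_pos_iff.2 (MvPolynomial.mem_support_iff.1 ha)
  obtain ⟨s, hs⟩ := exists_gt (max 1 (C / ‖D.coeff a‖))
  have hs1 : 1 < s := (le_max_left _ _).trans_lt hs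
  have hs2 : C < s * ‖D.coeff a‖ := (div_lt_iff₀ hapos).1 ((le_max_right _ _).trans_lt hs)
  have hmon : ∀ b, monomialNorm (fun i : Fin n => s ^ M ^ (i : ℕ)) b = s ^ e b := by
    intro b
    rw [monomialNorm, he, ← Finset.prod_pow_eq_pow_sum]
    refine Finset.prod_congr rfl fun i _ => ?_
    rw [← pow_mul, mul_comm]
  refine ⟨fun i => s ^ M ^ (i : ℕ), fun i => by positivity, a, ?_⟩
  have hsupp : (D - MvPolynomial.monomial a (D.coeff a)).support ⊆ D.support := by
    intro b hb
    rw [MvPolynomial.mem_support_iff, MvPolynomial.coeff_sub, MvPolynomial.coeff_monomial] at hb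
    rw [MvPolynomial.mem_support_iff]
    intro h0
    split_ifs at hb with hab
    · exact hb (by rw [hab, sub_self])
    · exact hb (by rw [h0, sub_zero])
  rw [l1Norm_eq_sum _ hsupp, hmon]
  refine lt_of_mul_lt_mul_left (a := s) ?_ (by positivity)
  calc s * ∑ b ∈ D.support, ‖(D - MvPolynomial.monomial a (D.coeff a)).coeff b‖ * _
      ≤ ∑ b ∈ D.support, ‖D.coeff b‖ * s ^ e a := by
        rw [Finset.mul_sum]
        refine Finset.sum_le_sum fun b hb => ?_
        rw [MvPolynomial.coeff_sub, MvPolynomial.coeff_monomial, hmon]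
        split_ifs with hab
        · subst hab
          simp only [sub_self, norm_zero, zero_mul, mul_zero]
          positivity
        · have hlt : e b < e a := lt_of_le_of_ne (hmax b hb) fun h => hab (hinj b hb a ha h).symm
          rw [sub_zero, mul_left_comm, ← pow_succ']
          gcongr
          · exact hs1.le
          · exact hlt
    _ = C * s ^ e a := by rw [hC, Finset.sum_mul]
    _ < s * ‖D.coeff a‖ * s ^ e a := by gcongr
    _ = _ := by ring

/-- Multiplication by a nonzero polynomial is bounded below in a suitable `ℓ¹`-norm. -/
theorem exists_l1Norm_mul_ge {D : MvPolynomial (Fin n) ℂ} (hD : D ≠ 0) :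
    ∃ ρ : Fin n → ℝ, (∀ i, 0 < ρ i) ∧ ∃ δ > 0, ∀ Q, δ * l1Norm ρ Q ≤ l1Norm ρ (D * Q) := by
  obtain ⟨ρ, hρ, a, ha⟩ := exists_dominant_monomial hD
  have hρ' : ∀ i, 0 ≤ ρ i := fun i => (hρ i).le
  refine ⟨ρ, hρ, _, sub_pos.2 ha, fun Q => ?_⟩
  set m := MvPolynomial.monomial a (D.coeff a) with hm
  -- Multiplication by the dominant monomial `m` scales the norm exactly; the remaining terms of `D`
  -- can cancel only a smaller multiple of `l1Norm ρ Q`.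
  have h1 : l1Norm ρ (m * Q) ≤ l1Norm ρ (D * Q) + l1Norm ρ ((D - m) * Q) := by
    rw [← l1Norm_neg ρ ((D - m) * Q)]
    refine le_trans (le_of_eq (congrArg _ ?_)) (l1Norm_add_le hρ' _ _)
    ring
  rw [hm, l1Norm_monomial_mul, ← hm] at h1
  have h2 := l1Norm_mul_le hρ' (D - m) Q
  linarith

theorem sum_l1Norm_weightedHomogeneousComponent_le {ρ : Fin n → ℝ} (hρ : ∀ i, 0 ≤ ρ i)
    (w : Fin n → ℕ) (P : MvPolynomial (Fin n) ℂ) (K : Finset ℕ) :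
    ∑ k ∈ K, l1Norm ρ (MvPolynomial.weightedHomogeneousComponent w k P) ≤ l1Norm ρ P := by
  classical
  have h : ∀ k, l1Norm ρ (MvPolynomial.weightedHomogeneousComponent w k P) =
      ∑ a ∈ P.support, if Finsupp.weight w a = k then ‖P.coeff a‖ * monomialNorm ρ a else 0 := by
    intro k
    rw [l1Norm_eq_sum (s := P.support)]
    · refine Finset.sum_congr rfl fun a _ => ?_
      rw [MvPolynomial.coeff_weightedHomogeneousComponent]
      split_ifs <;> simp
    · rw [MvPolynomial.support_weightedHomogeneousComponent]
      exact Finset.filter_subset _ _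
  simp only [h]
  rw [Finset.sum_comm]
  refine Finset.sum_le_sum fun a _ => ?_
  rw [Finset.sum_ite_eq]
  split_ifs
  · exact le_rfl
  · exact mul_nonneg (norm_nonneg _) (monomialNorm_nonneg hρ a)

/-- There are `n ^ k` words of length `k`; each contributes a monomial of size `r ^ k` with
coefficient at most `‖p k‖`, as basis vectors have norm one. -/
theorem l1Norm_seriesPoly_le (p : FormalMultilinearSeries ℂ (Fin n → ℂ) ℂ) {r : ℝ} (hr : 0 ≤ r)
    (k : ℕ) : l1Norm (fun _ => r) (seriesPoly p k) ≤ (n * r) ^ k * ‖p k‖ := by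
  refine (l1Norm_sum_le (fun _ => hr) _ _).trans ?_
  have : ∀ v : Fin k → Fin n, l1Norm (fun _ => r)
      (MvPolynomial.C (p k fun l => Pi.single (v l) 1) * ∏ l, MvPolynomial.X (v l)) ≤
      ‖p k‖ * r ^ k := by
    intro v
    have hX : (∏ l, MvPolynomial.X (v l) : MvPolynomial (Fin n) ℂ) =
        MvPolynomial.monomial (∑ l, Finsupp.single (v l) 1) 1 := by
      rw [MvPolynomial.monomial_sum_one]
      rfl
    rw [hX, MvPolynomial.C_mul_monomial, mul_one, ← mul_one (MvPolynomial.monomial _ _),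
      l1Norm_monomial_mul, monomialNorm_const, map_sum]
    have h1 : l1Norm (fun _ => r) (1 : MvPolynomial (Fin n) ℂ) = 1 := by
      simp [l1Norm, MvPolynomial.support_one, monomialNorm]
    have h2 := (p k).le_opNorm fun l => Pi.single (v l) (1 : ℂ)
    have h3 : ∏ l, ‖(Pi.single (v l) (1 : ℂ) : Fin n → ℂ)‖ = 1 :=
      Finset.prod_eq_one fun l _ => by rw [Pi.norm_single, norm_one]
    rw [h3, mul_one] at h2
    simp only [Finsupp.degree_single, Finset.sum_const, Finset.card_univ, Fintype.card_fin,
      smul_eq_mul, mul_one, h1]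
    gcongr
  refine (Finset.sum_le_sum fun v _ => this v).trans (le_of_eq ?_)
  simp [mul_pow]
  ring

theorem exists_summable_l1Norm_wcomp {w : Fin n → ℕ} (hw : ∀ i, 0 < w i) (g : O n) :
    ∃ r > 0, ∀ ρ : Fin n → ℝ, (∀ i, 0 ≤ ρ i) → (∀ i, ρ i ≤ r) →
      Summable fun k => l1Norm ρ (wcomp w k g) := by
  obtain ⟨F, hF, rfl⟩ := O.exists_mk g
  obtain ⟨p, R, hp⟩ := id hF
  obtain ⟨r₀, hr₀, hr₀'⟩ := ENNReal.lt_iff_exists_nnreal_btwn.1 (hp.r_pos.trans_le hp.r_le)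
  obtain ⟨C, hC, hb⟩ := p.norm_mul_pow_le_of_lt_radius hr₀'
  have hr₀pos : 0 < (r₀ : ℝ) := by exact_mod_cast hr₀
  -- This gives `n * r ≤ r₀ / 2`, hence a geometric bound with ratio `1 / 2`; `n + 1` avoids
  -- division by zero when `n = 0`.
  set r : ℝ := r₀ / (2 * (n + 1)) with hr
  have hrpos : 0 < r := by positivity
  have hser : ∀ k, l1Norm (fun _ => r) (seriesPoly p k) ≤ C * (1 / 2) ^ k := by
    intro k
    refine (l1Norm_seriesPoly_le p hrpos.le k).trans ?_
    have : (n * r : ℝ) ≤ 1 / 2 * r₀ := by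
      rw [hr, mul_div_assoc', div_le_iff₀ (by positivity)]
      nlinarith
    calc (n * r) ^ k * ‖p k‖ ≤ (1 / 2 * r₀) ^ k * ‖p k‖ := by gcongr
      _ = (‖p k‖ * r₀ ^ k) * (1 / 2) ^ k := by rw [mul_pow]; ring
      _ ≤ _ := by gcongr; exact hb k
  refine ⟨r, hrpos, fun ρ hρ hρr => ?_⟩
  refine summable_of_sum_range_le (c := C * 2) (fun k => l1Norm_nonneg hρ _) fun K => ?_
  set T := ∑ k ∈ Finset.range K, seriesPoly p k with hT
  have h1 : ∀ k ∈ Finset.range K, l1Norm ρ (wcomp w k (O.mk F hF)) =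
      l1Norm ρ (MvPolynomial.weightedHomogeneousComponent w k T) := by
    intro k hk
    rw [wcomp_eq hw (Finset.mem_range.1 hk)
      (mk_sub_ofPoly_mem_vanish hF hp.hasFPowerSeriesAt K)]
  rw [Finset.sum_congr rfl h1]
  refine (sum_l1Norm_weightedHomogeneousComponent_le hρ w T _).trans ?_
  refine (l1Norm_mono hρ hρr T).trans ?_
  refine (l1Norm_sum_le (fun _ => hrpos.le) _ _).trans ?_
  refine (Finset.sum_le_sum fun k _ => hser k).trans ?_
  rw [← Finset.mul_sum]
  gcongr
  have := (summable_geometric_two).sum_le_tsum (Finset.range K) fun i _ => by positivity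
  rwa [tsum_geometric_two] at this

/-- Writing a monomial as a product indexed by `Fin k` provides the multilinear form attached to it
in `coeffSeries`, and later degree estimates factor by factor. -/
theorem exists_word (k : ℕ) (a : Fin n →₀ ℕ) (hk : a.degree = k) :
    ∃ v : Fin k → Fin n,
      (∏ l, MvPolynomial.X (v l) : MvPolynomial (Fin n) ℂ) = MvPolynomial.monomial a 1 := by
  induction k generalizing a with
  | zero =>
    refine ⟨Fin.elim0, ?_⟩
    rw [(Finsupp.degree_eq_zero_iff a).1 hk]
    simp
  | succ k ih =>
    obtain ⟨i, hi⟩ : ∃ i, a i ≠ 0 := by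
      by_contra! h
      rw [show a = 0 from Finsupp.ext h] at hk
      simp at hk
    have ha : a = Finsupp.single i 1 + (a - Finsupp.single i 1) :=
      (add_tsub_cancel_of_le (by simpa using Nat.one_le_iff_ne_zero.2 hi)).symm
    have hdeg : (a - Finsupp.single i 1).degree = k := by
      have := congrArg Finsupp.degree ha
      rw [map_add, Finsupp.degree_single] at this
      omega
    obtain ⟨v, hv⟩ := ih _ hdeg
    refine ⟨Fin.cons i v, ?_⟩
    rw [Fin.prod_univ_succ]
    simp only [Fin.cons_zero, Fin.cons_succ, hv]
    conv_rhs => rw [ha]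
    rw [MvPolynomial.X, MvPolynomial.monomial_mul, one_mul]

/-- The finite set of exponents of a given total degree. -/
def exponents (n k : ℕ) : Finset (Fin n →₀ ℕ) := Finset.finsuppAntidiag Finset.univ k

theorem mem_exponents {k : ℕ} {a : Fin n →₀ ℕ} : a ∈ exponents n k ↔ a.degree = k := by
  rw [exponents, Finset.mem_finsuppAntidiag, Finsupp.degree_eq_sum]
  simp

/-- A formal multilinear series with prescribed coefficients. -/
def coeffSeries (c : (Fin n →₀ ℕ) → ℂ) : FormalMultilinearSeries ℂ (Fin n → ℂ) ℂ := fun k =>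
  ∑ a ∈ (exponents n k).attach, c a.1 •
    (ContinuousMultilinearMap.mkPiAlgebraFin ℂ k ℂ).compContinuousLinearMap fun l =>
      ContinuousLinearMap.proj ((exists_word k a.1 (mem_exponents.1 a.2)).choose l)

theorem norm_coeffSeries_le (c : (Fin n →₀ ℕ) → ℂ) (k : ℕ) :
    ‖coeffSeries c k‖ ≤ ∑ a ∈ exponents n k, ‖c a‖ := by
  rw [← Finset.sum_attach]
  refine (norm_sum_le _ _).trans (Finset.sum_le_sum fun a _ => ?_)
  rw [norm_smul]
  refine mul_le_of_le_one_right (norm_nonneg _) ?_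
  refine ContinuousMultilinearMap.opNorm_le_bound zero_le_one fun m => ?_
  rw [ContinuousMultilinearMap.compContinuousLinearMap_apply,
    ContinuousMultilinearMap.mkPiAlgebraFin_apply, List.prod_ofFn, one_mul, norm_prod]
  exact Finset.prod_le_prod (fun l _ => norm_nonneg _) fun l _ => norm_le_pi_norm (m l) _

theorem seriesPoly_coeffSeries (c : (Fin n →₀ ℕ) → ℂ) (k : ℕ) :
    seriesPoly (coeffSeries c) k = ∑ a ∈ exponents n k, MvPolynomial.monomial a (c a) := by
  refine MvPolynomial.funext fun x => ?_
  rw [eval_seriesPoly, ← Finset.sum_attach, map_sum, coeffSeries, sum_apply]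
  refine Finset.sum_congr rfl fun a _ => ?_
  have h := congrArg (MvPolynomial.eval x) (exists_word k a.1 (mem_exponents.1 a.2)).choose_spec
  rw [map_prod] at h
  simp only [MvPolynomial.eval_X] at h
  rw [smul_apply, ContinuousMultilinearMap.compContinuousLinearMap_apply,
    ContinuousMultilinearMap.mkPiAlgebraFin_apply, List.prod_ofFn, 
    ← mul_one (c a.1), ← MvPolynomial.C_mul_monomial, map_mul, MvPolynomial.eval_C, ← h]
  simp

/-- A converse to `exists_summable_l1Norm_wcomp`. Summability bounds the coefficients on the
polyradius `ρ`, hence on a polydisc of constant radius `r ≤ ρ i`, so the assembled series has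
positive radius of convergence. -/
theorem exists_wcomp_eq_of_summable {w : Fin n → ℕ} (hw : ∀ i, 0 < w i) {ρ : Fin n → ℝ}
    (hρ : ∀ i, 0 < ρ i) {q : ℕ → MvPolynomial (Fin n) ℂ}
    (hq : ∀ k, (q k).IsWeightedHomogeneous w k) (hs : Summable fun k => l1Norm ρ (q k)) :
    ∃ g : O n, ∀ k, wcomp w k g = q k := by
  classical
  have hρ' : ∀ i, 0 ≤ ρ i := fun i => (hρ i).le
  obtain ⟨r, hr, hrρ⟩ : ∃ r > 0, ∀ i, r ≤ ρ i := by
    cases isEmpty_or_nonempty (Fin n) with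
    | inl h => exact ⟨1, one_pos, fun i => h.elim i⟩
    | inr h =>
      obtain ⟨i, hi⟩ := Finite.exists_min ρ
      exact ⟨ρ i, hρ i, hi⟩
  -- The monomial with exponent `a` can occur in only one of the `q k`, the one indexed by its
  -- weight.
  set c : (Fin n →₀ ℕ) → ℂ := fun a => (q (Finsupp.weight w a)).coeff a with hc
  have hbound : ∀ s : Finset (Fin n →₀ ℕ),
      ∑ a ∈ s, ‖c a‖ * monomialNorm ρ a ≤ ∑' k, l1Norm ρ (q k) := by
    intro s
    rw [← Finset.sum_fiberwise_of_maps_to (g := Finsupp.weight w) (t := s.image (Finsupp.weight w))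
      fun a ha => Finset.mem_image_of_mem _ ha]
    refine (Finset.sum_le_sum fun k _ => ?_).trans
      (hs.sum_le_tsum _ fun k _ => l1Norm_nonneg hρ' _)
    rw [l1Norm_eq_sum ρ (Finset.subset_union_left (s₂ := s.filter fun a => Finsupp.weight w a = k))]
    calc _ = ∑ a ∈ s with Finsupp.weight w a = k, ‖(q k).coeff a‖ * monomialNorm ρ a := by
          refine Finset.sum_congr rfl fun a ha => ?_
          rw [hc, ← (Finset.mem_filter.1 ha).2]
      _ ≤ _ := Finset.sum_le_sum_of_subset_of_nonneg Finset.subset_union_right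
          fun a _ _ => mul_nonneg (norm_nonneg _) (monomialNorm_nonneg hρ' a)
  have hrad : 0 < (coeffSeries c).radius := by
    have : ENNReal.ofNNReal ⟨r, hr.le⟩ ≤ (coeffSeries c).radius := by
      refine FormalMultilinearSeries.le_radius_of_bound _ (∑' k, l1Norm ρ (q k)) fun k => ?_
      refine (mul_le_mul_of_nonneg_right (norm_coeffSeries_le c k) (by positivity)).trans ?_
      refine le_trans ?_ (hbound (exponents n k))
      rw [Finset.sum_mul]
      refine Finset.sum_le_sum fun a ha => mul_le_mul_of_nonneg_left ?_ (norm_nonneg _)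
      rw [← mem_exponents.1 ha, ← monomialNorm_const]
      exact monomialNorm_mono (fun _ => hr.le) hrρ a
    exact lt_of_lt_of_le (ENNReal.coe_pos.2 hr) this
  have hp := (coeffSeries c).hasFPowerSeriesOnBall hrad
  refine ⟨O.mk _ hp.analyticAt, fun k => ?_⟩
  rw [wcomp_eq hw k.lt_succ_self
    (mk_sub_ofPoly_mem_vanish hp.analyticAt hp.hasFPowerSeriesAt (k + 1))]
  ext a
  rw [MvPolynomial.coeff_weightedHomogeneousComponent]
  split_ifs with ha
  · simp only [seriesPoly_coeffSeries, MvPolynomial.coeff_sum, MvPolynomial.coeff_monomial]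
    rw [Finset.sum_eq_single a.degree]
    · rw [Finset.sum_ite_eq', if_pos (mem_exponents.2 rfl), hc, ← ha]
    · intro j _ hj
      rw [Finset.sum_ite_eq', if_neg]
      rw [mem_exponents]
      exact hj.symm
    · intro h
      refine absurd (Finset.mem_range.2 ?_) h
      have := degree_le_weight hw a
      omega
  · exact ((hq k).coeff_eq_zero a ha).symm

/-- Divisibility of a germ by a weighted homogeneous polynomial can be tested on the weighted
homogeneous components. -/
theorem ofPoly_dvd_of_dvd_wcomp {w : Fin n → ℕ} (hw : ∀ i, 0 < w i) {D : MvPolynomial (Fin n) ℂ}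
    {e : ℕ} (hD : D.IsWeightedHomogeneous w e) (hD0 : D ≠ 0) {g : O n}
    (h : ∀ k, D ∣ wcomp w k g) : ofPoly D ∣ g := by
  have hq : ∀ k, ∃ q : MvPolynomial (Fin n) ℂ, q.IsWeightedHomogeneous w k ∧
      D * q = wcomp w (e + k) g := by
    intro k
    obtain ⟨q, hq⟩ := h (e + k)
    -- The polynomial quotient may be replaced by its component of degree `k`, since `D` and the
    -- dividend are homogeneous.
    refine ⟨wcomp w k (ofPoly q), wcomp_isWeightedHomogeneous _ _ _, ?_⟩
    rw [← wcomp_ofPoly_mul hw hD, ← map_mul, ← hq, wcomp_ofPoly hw,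
      (wcomp_isWeightedHomogeneous _ _ _).weightedHomogeneousComponent_same]
  have hlow : ∀ k < e, wcomp w k g = 0 := by
    intro k hk
    obtain ⟨q, hq⟩ := h k
    have := wcomp_ofPoly_mul_of_lt hw hD hk (ofPoly q)
    rwa [← map_mul, ← hq, wcomp_ofPoly hw,
      (wcomp_isWeightedHomogeneous _ _ _).weightedHomogeneousComponent_same] at this
  choose q hqh hq using hq
  obtain ⟨ρ, hρ, δ, hδ, hle⟩ := exists_l1Norm_mul_ge hD0
  obtain ⟨r, hr, hsum⟩ := exists_summable_l1Norm_wcomp hw g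
  -- The lower bound for multiplication by `D` holds at `ρ`, whereas the components of `g` are
  -- summable only at small radii. The weighted scaling by `t` joins the two: homogeneous
  -- polynomials scale exactly, so the bound survives at `ρ'` with constant `δ * t ^ e`.
  obtain ⟨t, ht, ht1, htr⟩ : ∃ t : ℝ, 0 < t ∧ t ≤ 1 ∧ ∀ i, t * ρ i ≤ r := by
    obtain ⟨B, hB⟩ := Finite.exists_le ρ
    have hpos : 0 < r / (|B| + 1) := by positivity
    refine ⟨min 1 (r / (|B| + 1)), lt_min one_pos hpos, min_le_left _ _, fun i => ?_⟩
    calc _ ≤ r / (|B| + 1) * (|B| + 1) := by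
          gcongr
          · exact (hρ i).le
          · exact min_le_right _ _
          · linarith [hB i, le_abs_self B]
      _ = r := by field_simp
  set ρ' : Fin n → ℝ := fun i => t ^ w i * ρ i with hρ'
  have hρ'pos : ∀ i, 0 < ρ' i := fun i => mul_pos (pow_pos ht _) (hρ i)
  have hs := hsum ρ' (fun i => (hρ'pos i).le) fun i => by
    refine le_trans ?_ (htr i)
    exact mul_le_mul_of_nonneg_right (pow_le_of_le_one ht.le ht1 (hw i).ne') (hρ i).le
  have hs' : Summable fun k => l1Norm ρ' (q k) := by
    have h1 : Summable fun k => (δ * t ^ e)⁻¹ * l1Norm ρ' (wcomp w (e + k) g) := by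
      refine Summable.mul_left _ ?_
      simpa [add_comm] using (summable_nat_add_iff e).2 hs
    refine Summable.of_nonneg_of_le (fun k => l1Norm_nonneg (fun i => (hρ'pos i).le) _)
      (fun k => ?_) h1
    rw [le_inv_mul_iff₀ (by positivity), ← hq, hρ', l1Norm_scale (hqh k),
      l1Norm_scale (hD.mul (hqh k)), pow_add]
    have := mul_le_mul_of_nonneg_left (hle (q k)) (show 0 ≤ t ^ e * t ^ k by positivity)
    linarith
  obtain ⟨G, hG⟩ := exists_wcomp_eq_of_summable hw hρ'pos hqh hs'
  refine ⟨G, eq_of_wcomp hw fun k => ?_⟩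
  rcases lt_or_ge k e with hk | hk
  · rw [hlow k hk, wcomp_ofPoly_mul_of_lt hw hD hk]
  · obtain ⟨k, rfl⟩ := Nat.exists_eq_add_of_le hk
    rw [wcomp_ofPoly_mul hw hD, hG, hq]

end

/-! ### Derivatives, the chain rule and pull-back of weighted components -/

section

variable {n p : ℕ}

theorem analyticAt_fderiv_apply {F : (Fin n → ℂ) → ℂ} (hF : AnalyticAt ℂ F 0) (i : Fin n) :
    AnalyticAt ℂ (fun x => fderiv ℂ F x (Pi.single i 1)) 0 :=
  ((ContinuousLinearMap.apply ℂ ℂ (Pi.single i 1 : Fin n → ℂ)).analyticAt _).comp hF.fderiv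

theorem pderiv_mk (i : Fin n) {F : (Fin n → ℂ) → ℂ} (hF : AnalyticAt ℂ F 0) :
    pderiv i (O.mk F hF) =
      O.mk (fun x => fderiv ℂ F x (Pi.single i 1)) (analyticAt_fderiv_apply hF i) :=
  rfl

theorem pderiv_add (i : Fin n) (g g' : O n) : pderiv i (g + g') = pderiv i g + pderiv i g' := by
  obtain ⟨F, hF, rfl⟩ := O.exists_mk g
  obtain ⟨G, hG, rfl⟩ := O.exists_mk g'
  rw [O.mk_add, pderiv_mk, pderiv_mk, pderiv_mk, O.mk_add, O.mk_eq_mk]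
  filter_upwards [hF.eventually_analyticAt, hG.eventually_analyticAt] with x hx hx'
  rw [fderiv_fun_add hx.differentiableAt hx'.differentiableAt]
  rfl

theorem pderiv_mul (i : Fin n) (g g' : O n) :
    pderiv i (g * g') = g * pderiv i g' + pderiv i g * g' := by
  obtain ⟨F, hF, rfl⟩ := O.exists_mk g
  obtain ⟨G, hG, rfl⟩ := O.exists_mk g'
  rw [O.mk_mul, pderiv_mk, pderiv_mk, pderiv_mk, O.mk_mul, O.mk_mul, O.mk_add, O.mk_eq_mk]
  filter_upwards [hF.eventually_analyticAt, hG.eventually_analyticAt] with x hx hx'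
  rw [fderiv_fun_mul hx.differentiableAt hx'.differentiableAt]
  simp [mul_comm]

theorem pderiv_coord (i j : Fin n) : pderiv i (coord j) = if i = j then 1 else 0 := by
  rw [coord, pderiv_mk]
  have : ∀ x : Fin n → ℂ, fderiv ℂ (fun x : Fin n → ℂ => x j) x (Pi.single i 1) =
      if i = j then 1 else 0 := by
    intro x
    rw [fderiv_apply (Φ := fun x : Fin n → ℂ => x) differentiableAt_id]
    simp [Pi.single_apply, eq_comm]
  split_ifs with h
  · change _ = O.mk (fun _ => 1) analyticAt_const
    rw [O.mk_eq_mk]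
    exact Eventually.of_forall fun x => (this x).trans (if_pos h)
  · rw [O.zero_eq_mk, O.mk_eq_mk]
    exact Eventually.of_forall fun x => (this x).trans (if_neg h)

theorem pderiv_ofPoly (i : Fin n) (a : MvPolynomial (Fin n) ℂ) :
    pderiv i (ofPoly a) = ofPoly (MvPolynomial.pderiv i a) := by
  induction a using MvPolynomial.induction_on with
  | C c =>
    rw [MvPolynomial.pderiv_C, map_zero, ofPoly, MvPolynomial.aeval_C, O.algebraMap_eq_mk,
      pderiv_mk, O.zero_eq_mk, O.mk_eq_mk]
    simp
  | add p q hp hq => rw [map_add, pderiv_add, hp, hq, map_add, map_add]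
  | mul_X p j hp =>
    rw [map_mul, pderiv_mul, hp, Derivation.leibniz, MvPolynomial.pderiv_X, ofPoly_X, pderiv_coord,
      map_add, smul_eq_mul, smul_eq_mul, map_mul, map_mul, ofPoly_X, mul_comm (coord j)]
    congr 2
    simp only [Pi.single_apply, eq_comm]
    split_ifs <;> simp

namespace MapGerm

theorem analyticAt_comp (f : MapGerm n p) {G : (Fin p → ℂ) → ℂ} (hG : AnalyticAt ℂ G 0) :
    AnalyticAt ℂ (fun x => G (f.toFun x)) 0 :=
  AnalyticAt.comp (by rwa [f.map_zero]) f.analyticAt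

theorem pullback_mk (f : MapGerm n p) {G : (Fin p → ℂ) → ℂ} (hG : AnalyticAt ℂ G 0) :
    f.pullback (O.mk G hG) = O.mk (fun x => G (f.toFun x)) (f.analyticAt_comp hG) := rfl

theorem pullback_coord (f : MapGerm n p) (j : Fin p) : f.pullback (coord j) = f.comp j := rfl

theorem pullback_mem_vanish (f : MapGerm n p) {N : ℕ} {g : O p} (hg : g ∈ vanish p N) :
    f.pullback g ∈ vanish n N := by
  obtain ⟨G, hG, rfl⟩ := O.exists_mk g
  rw [mk_mem_vanish] at hg
  rw [pullback_mk, mk_mem_vanish]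
  have h1 : f.toFun =O[𝓝 0] fun x => ‖x‖ := by
    simpa [f.map_zero] using f.analyticAt.differentiableAt.isBigO_sub.norm_right
  exact (hg.comp_tendsto f.tendsto).trans (h1.norm_left.pow N)

/-- The chain rule for the pull-back of a germ. -/
theorem pderiv_pullback (f : MapGerm n p) (g : O p) (i : Fin n) :
    pderiv i (f.pullback g) = ∑ j, f.pullback (pderiv j g) * f.jacobianMatrix j i := by
  obtain ⟨G, hG, rfl⟩ := O.exists_mk g
  simp only [jacobianMatrix, Matrix.of_apply, MapGerm.comp, pullback_mk, pderiv_mk, O.mk_mul]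
  rw [O.mk_sum, O.mk_eq_mk]
  have hG' : ∀ᶠ x in 𝓝 0, AnalyticAt ℂ G (f.toFun x) := f.tendsto hG.eventually_analyticAt
  filter_upwards [f.analyticAt.eventually_analyticAt, hG'] with x hx hx'
  have h1 := (hx'.differentiableAt.hasFDerivAt.comp x hx.differentiableAt.hasFDerivAt).fderiv
  change fderiv ℂ (G ∘ f.toFun) x _ = _
  rw [h1, ContinuousLinearMap.comp_apply]
  conv_lhs => rw [pi_eq_sum_univ' (fderiv ℂ f.toFun x (Pi.single i 1)), map_sum]
  refine Finset.sum_congr rfl fun j _ => ?_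
  rw [map_smul, smul_eq_mul, mul_comm, fderiv_apply hx.differentiableAt]
  rfl

end MapGerm

section

variable {w : Fin n → ℕ} {d : Fin p → ℕ} {P : Fin p → MvPolynomial (Fin n) ℂ}

theorem aeval_monomial_isWeightedHomogeneous
    (hP : ∀ j, (P j).IsWeightedHomogeneous w (d j)) (b : Fin p →₀ ℕ) (c : ℂ) :
    (MvPolynomial.aeval P (MvPolynomial.monomial b c)).IsWeightedHomogeneous w
      (Finsupp.weight d b) := by
  rw [MvPolynomial.aeval_monomial, Finsupp.weight_apply, Finsupp.prod, Finsupp.sum]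
  have h := MvPolynomial.IsWeightedHomogeneous.prod b.support (fun j => P j ^ b j)
    (fun j => b j • d j) fun j _ => (hP j).pow (b j)
  exact h.C_mul c

theorem weightedHomogeneousComponent_aeval (hP : ∀ j, (P j).IsWeightedHomogeneous w (d j)) (k : ℕ)
    (a : MvPolynomial (Fin p) ℂ) :
    MvPolynomial.weightedHomogeneousComponent w k (MvPolynomial.aeval P a) =
      MvPolynomial.aeval P (MvPolynomial.weightedHomogeneousComponent d k a) := by
  classical
  induction a using MvPolynomial.induction_on' with
  | monomial b c =>
    rw [MvPolynomial.weightedHomogeneousComponent_of_mem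
        (aeval_monomial_isWeightedHomogeneous hP b c),
      MvPolynomial.weightedHomogeneousComponent_of_mem
        (MvPolynomial.isWeightedHomogeneous_monomial d b c rfl)]
    split_ifs <;> simp
  | add q r hq hr => simp only [map_add, hq, hr]

variable {f : MapGerm n p}

theorem comp_eq_ofPoly (hf : ∀ᶠ x in 𝓝 (0 : Fin n → ℂ), ∀ j, f.toFun x j = MvPolynomial.eval x (P j))
    (j : Fin p) : f.comp j = ofPoly (P j) := by
  rw [ofPoly_eq_mk, MapGerm.comp, O.mk_eq_mk]
  filter_upwards [hf] with x hx using hx j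

theorem pullback_ofPoly (hf : ∀ j, f.comp j = ofPoly (P j)) (a : MvPolynomial (Fin p) ℂ) :
    f.pullback (ofPoly a) = ofPoly (MvPolynomial.aeval P a) := by
  have : f.pullback.comp ofPoly = ofPoly.comp (MvPolynomial.aeval P) := by
    ext j
    simp [MapGerm.pullback_coord, hf]
  exact DFunLike.congr_fun this a

/-- Substituting components of degree `d j` turns the weights `d` of the target into weighted
degrees of the source. Hence relations between germs can be read degree by degree as relations
between polynomials. -/
theorem wcomp_pullback (hw : ∀ i, 0 < w i) (hd : ∀ j, 0 < d j)
    (hP : ∀ j, (P j).IsWeightedHomogeneous w (d j)) (hf : ∀ j, f.comp j = ofPoly (P j))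
    (k : ℕ) (g : O p) :
    wcomp w k (f.pullback g) = MvPolynomial.aeval P (wcomp d k g) := by
  obtain ⟨a, ha⟩ := exists_truncation g (k + 1)
  have h1 := f.pullback_mem_vanish ha
  rw [map_sub, pullback_ofPoly hf] at h1
  rw [wcomp_eq hw k.lt_succ_self h1, wcomp_eq hd k.lt_succ_self ha,
    weightedHomogeneousComponent_aeval hP]

end

end

/-! ### The polynomial model, the equation of the image and Euler's identity -/

section

variable {n p : ℕ}

/-- Weighted homogeneous polynomials representing the components of a map-germ. -/
structure Model (f : MapGerm n p) where
  w : Fin n → ℕ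
  d : Fin p → ℕ
  P : Fin p → MvPolynomial (Fin n) ℂ
  w_pos : ∀ i, 0 < w i
  d_pos : ∀ j, 0 < d j
  hom : ∀ j, (P j).IsWeightedHomogeneous w (d j)
  comp_eq : ∀ j, f.comp j = ofPoly (P j)

theorem MapGerm.IsWeightedHomogeneous.exists_model {f : MapGerm n p}
    (hf : f.IsWeightedHomogeneous) : Nonempty (Model f) := by
  obtain ⟨w, d, P, hw, hd, hP, hev⟩ := hf
  exact ⟨⟨w, d, P, hw, hd, hP, comp_eq_ofPoly hev⟩⟩

namespace Model

variable {f : MapGerm n p} (m : Model f)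

/-- The pull-back of polynomials. -/
def φ : MvPolynomial (Fin p) ℂ →ₐ[ℂ] MvPolynomial (Fin n) ℂ := MvPolynomial.aeval m.P

theorem pullback_ofPoly (a : MvPolynomial (Fin p) ℂ) : f.pullback (ofPoly a) = ofPoly (m.φ a) :=
  MondGerm.pullback_ofPoly m.comp_eq a

theorem wcomp_pullback (k : ℕ) (g : O p) : wcomp m.w k (f.pullback g) = m.φ (wcomp m.d k g) :=
  MondGerm.wcomp_pullback m.w_pos m.d_pos m.hom m.comp_eq k g

end Model

theorem wcomp_zero_of_mem_vanish {w : Fin n → ℕ} (hw : ∀ i, 0 < w i) {g : O n}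
    (hg : g ∈ vanish n 1) : wcomp w 0 g = 0 := by
  rw [wcomp_eq hw (P := 0) one_pos (by simpa using hg), _root_.map_zero]

/-- By transcendence degree, `n + 1` polynomials in `n` variables are algebraically dependent. This
forces the equation of the image to be nonzero. -/
theorem exists_aeval_eq_zero (P : Fin (n + 1) → MvPolynomial (Fin n) ℂ) :
    ∃ Q : MvPolynomial (Fin (n + 1)) ℂ, Q ≠ 0 ∧ MvPolynomial.aeval P Q = 0 := by
  by_contra! h
  have hP : AlgebraicIndependent ℂ P := by
    rw [algebraicIndependent_iff]
    intro Q hQ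
    by_contra hne
    exact h Q hne hQ
  have := hP.lift_cardinalMk_le_trdeg
  rw [MvPolynomial.trdeg_of_isDomain] at this
  simp at this

/-- A weighted homogeneous polynomial `H` of positive degree that is associated to the germ `h`. -/
structure Equation {f : MapGerm n p} (m : Model f) (h : O p) where
  H : MvPolynomial (Fin p) ℂ
  e : ℕ
  u : O p
  e_pos : 0 < e
  ne_zero : H ≠ 0
  hom : H.IsWeightedHomogeneous m.d e
  isUnit : IsUnit u
  eq : h = u * ofPoly H

theorem MapGerm.IsImageEquation.pullback_eq_zero_iff {f : MapGerm n p} {h : O p}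
    (hh : f.IsImageEquation h) {g : O p} : f.pullback g = 0 ↔ h ∣ g := by
  rw [← Ideal.mem_span_singleton, hh]
  rfl

theorem MapGerm.IsImageEquation.ne_zero {f : MapGerm n (n + 1)} (m : Model f) {h : O (n + 1)}
    (hh : f.IsImageEquation h) : h ≠ 0 := by
  rintro rfl
  obtain ⟨Q, hQ, hQ'⟩ := exists_aeval_eq_zero m.P
  have h1 := m.pullback_ofPoly Q
  rw [Model.φ, hQ', _root_.map_zero, hh.pullback_eq_zero_iff, zero_dvd_iff] at h1
  exact hQ (ofPoly_injective (by rw [h1, _root_.map_zero]))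

theorem MapGerm.IsImageEquation.exists_equation {f : MapGerm n p} (m : Model f) {h : O p}
    (hh : f.IsImageEquation h) (h0 : h ≠ 0) : Nonempty (Equation m h) := by
  obtain ⟨e, he, hlow⟩ := ofPoly_wcomp_lowest m.d_pos h0
  set H := wcomp m.d e h with hH
  have hpb : f.pullback h = 0 := hh.pullback_eq_zero_iff.2 dvd_rfl
  have hφ : m.φ H = 0 := by rw [hH, ← m.wcomp_pullback, hpb, wcomp_zero m.w_pos]
  obtain ⟨q, hq⟩ : h ∣ ofPoly H := by
    rw [← hh.pullback_eq_zero_iff, m.pullback_ofPoly, hφ, _root_.map_zero]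
  have hhom : H.IsWeightedHomogeneous m.d e := wcomp_isWeightedHomogeneous _ _ _
  -- As `h` has no component below degree `e`, the degree `e` part of `ofPoly H = h * q` is `H`
  -- times the constant term of `q`; that term cannot vanish, so `q` is a unit.
  have hq0 : wcomp m.d 0 q ≠ 0 := by
    intro hq0
    have h1 := wcomp_mul m.d_pos e h q
    rw [← hq, wcomp_ofPoly m.d_pos, hhom.weightedHomogeneousComponent_same,
      Finset.sum_eq_zero] at h1
    · exact he h1
    · rintro ⟨i, j⟩ hij
      rw [Finset.HasAntidiagonal.mem_antidiagonal] at hij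
      simp only at hij
      rcases eq_or_ne j 0 with rfl | hj
      · rw [hq0, mul_zero]
      · rw [hlow i (by omega), zero_mul]
  have hqu : IsUnit q := isUnit_of_notMem_vanish fun hv => hq0 (wcomp_zero_of_mem_vanish m.d_pos hv)
  -- For `e = 0` the germ `h` would be a unit, and so would its pull-back, which is zero.
  have he0 : 0 < e := by
    rw [Nat.pos_iff_ne_zero]
    rintro rfl
    refine he (wcomp_zero_of_mem_vanish m.d_pos ?_)
    by_contra hv
    have := (isUnit_of_notMem_vanish hv).map f.pullback
    rw [hpb] at this
    exact not_isUnit_zero this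
  obtain ⟨v, rfl⟩ := hqu
  exact ⟨⟨H, e, ↑v⁻¹, he0, he, hhom, v⁻¹.isUnit, by rw [hq, mul_left_comm, Units.inv_mul, mul_one]⟩⟩

namespace Equation

variable {f : MapGerm n p} {m : Model f} {h : O p}

theorem h_dvd_iff (E : Equation m h) {g : O p} : h ∣ g ↔ ofPoly E.H ∣ g := by
  conv_lhs => rw [E.eq]
  exact E.isUnit.mul_left_dvd

/-- Euler's identity for germs. -/
theorem sum_coord_mul_pderiv (E : Equation m h) :
    ∑ j, (m.d j : O p) * (coord j * pderiv j (ofPoly E.H)) = (E.e : O p) * ofPoly E.H := by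
  have := congrArg ofPoly E.hom.sum_weight_X_mul_pderiv
  simpa [map_sum, ← pderiv_ofPoly] using this

theorem natCast_e_add_isUnit (E : Equation m h) {v r : O p} (hv : IsUnit v) (hr : r ∈ vanish p 1) :
    IsUnit ((E.e : O p) * v + r) := by
  refine isUnit_of_notMem_vanish fun hmem => ?_
  have h1 : (E.e : O p) * v ∈ vanish p 1 := by simpa using Ideal.sub_mem _ hmem hr
  have he : IsUnit (E.e : O p) := by
    have := (IsUnit.mk0 (E.e : ℂ) (by exact_mod_cast E.e_pos.ne')).map (algebraMap ℂ (O p))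
    simpa using this
  have := Ideal.eq_top_of_isUnit_mem _ h1 (he.mul hv)
  exact one_notMem_vanish_one (this ▸ Submodule.mem_top)

/-- The Euler field `∑ d_j y_j ∂_j` applied to `h = u H` gives `(e u + r) H`, with `r` in the
maximal ideal. The factor `e u + r` is a unit, so `H`, and with it `h`, lies in `J_h`. -/
theorem mem_jacobianIdeal (E : Equation m h) : h ∈ jacobianIdeal h := by
  set r : O p := ∑ j, (m.d j : O p) * (coord j * pderiv j E.u) with hr
  have hr' : r ∈ vanish p 1 := Ideal.sum_mem _ fun j _ => Ideal.mul_mem_left _ _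
    (Ideal.mul_mem_right _ _ (coord_mem_vanish j))
  have h1 : ∑ j, (m.d j : O p) * (coord j * pderiv j h) =
      ((E.e : O p) * E.u + r) * ofPoly E.H := by
    have h2 := E.sum_coord_mul_pderiv
    conv_lhs => rw [E.eq]
    calc _ = E.u * ∑ j, (m.d j : O p) * (coord j * pderiv j (ofPoly E.H)) + r * ofPoly E.H := by
          rw [hr, Finset.mul_sum, Finset.sum_mul, ← Finset.sum_add_distrib]
          refine Finset.sum_congr rfl fun j _ => ?_
          rw [pderiv_mul]
          ring
      _ = _ := by rw [h2]; ring
  have h3 : ((E.e : O p) * E.u + r) * ofPoly E.H ∈ jacobianIdeal h := by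
    rw [← h1]
    exact Ideal.sum_mem _ fun j _ => Ideal.mul_mem_left _ _ (Ideal.mul_mem_left _ _
      (Ideal.subset_span ⟨j, rfl⟩))
  have h4 := (Ideal.unit_mul_mem_iff_mem _ (E.natCast_e_add_isUnit E.isUnit hr')).1 h3
  have h5 := Ideal.mul_mem_left _ E.u h4
  rwa [← E.eq] at h5

theorem pullback_pderiv (E : Equation m h) (hh : f.IsImageEquation h) (j : Fin p) :
    f.pullback (pderiv j h) = f.pullback E.u * ofPoly (m.φ (MvPolynomial.pderiv j E.H)) := by
  have h1 : pderiv j h = E.u * pderiv j (ofPoly E.H) + pderiv j E.u * ofPoly E.H := by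
    conv_lhs => rw [E.eq]
    rw [pderiv_mul]
  have h2 : f.pullback (ofPoly E.H) = 0 := hh.pullback_eq_zero_iff.2 (E.h_dvd_iff.2 dvd_rfl)
  rw [h1, map_add, map_mul, map_mul, h2, mul_zero, add_zero, pderiv_ofPoly, m.pullback_ofPoly]

/-- Otherwise `H` divides all its partial derivatives; cancelling `H` in Euler's identity would put
the nonzero constant `e` in the maximal ideal. -/
theorem exists_pullback_pderiv_ne_zero (E : Equation m h) (hh : f.IsImageEquation h) :
    ∃ j, f.pullback (pderiv j h) ≠ 0 := by
  by_contra! hz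
  have h1 : ∀ j, ofPoly E.H ∣ pderiv j (ofPoly E.H) := by
    intro j
    rw [← E.h_dvd_iff, ← hh.pullback_eq_zero_iff, pderiv_ofPoly, m.pullback_ofPoly]
    have h2 := hz j
    rw [E.pullback_pderiv hh] at h2
    exact (mul_eq_zero.1 h2).resolve_left (E.isUnit.map f.pullback).ne_zero
  choose q hq using h1
  have hH : ofPoly E.H ≠ 0 := fun h0 => E.ne_zero (ofPoly_injective (by rw [h0, _root_.map_zero]))
  have h3 : (E.e : O p) = ∑ j, (m.d j : O p) * (coord j * q j) := by
    refine mul_right_cancel₀ hH ?_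
    rw [← E.sum_coord_mul_pderiv, Finset.sum_mul]
    refine Finset.sum_congr rfl fun j _ => ?_
    rw [hq j]
    ring
  have h4 : (E.e : O p) ∈ vanish p 1 := by
    rw [h3]
    exact Ideal.sum_mem _ fun j _ => Ideal.mul_mem_left _ _
      (Ideal.mul_mem_right _ _ (coord_mem_vanish j))
  have h5 := E.natCast_e_add_isUnit isUnit_one (Ideal.zero_mem _)
  rw [mul_one, add_zero] at h5
  have := Ideal.eq_top_of_isUnit_mem _ h4 h5
  exact one_notMem_vanish_one (this ▸ Submodule.mem_top)

end Equation

end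

/-! ### Homogeneous primes, maximal minors and ramification in codimension two -/

section

variable {n p : ℕ}

/-- The prime factors of `a` are stripped one at a time: for each `π` some `D l` is not divisible by
`π`, so `π` has to divide the cofactor of `x`. -/
theorem dvd_of_forall_dvd_mul {R ι : Type*} [CommRing R] [IsDomain R] [UniqueFactorizationMonoid R]
    {D : ι → R} {a x : R} (ha : a ≠ 0) (hp : ∀ π, Prime π → π ∣ a → ∃ l, ¬ π ∣ D l)
    (hx : ∀ l, a ∣ D l * x) : a ∣ x := by
  induction a using UniqueFactorizationMonoid.induction_on_prime generalizing x with
  | h₁ => exact absurd rfl ha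
  | h₂ a hu => exact hu.dvd
  | h₃ b π hb hπ ih =>
    obtain ⟨y, rfl⟩ := ih hb (fun π' h h' => hp π' h (h'.mul_left π))
      fun l => (dvd_mul_left b π).trans (hx l)
    obtain ⟨l, hl⟩ := hp π hπ (dvd_mul_right π b)
    have h1 := hx l
    rw [mul_left_comm, mul_comm π b] at h1
    have h2 := (hπ.dvd_or_dvd ((mul_dvd_mul_iff_left hb).1 h1)).resolve_left hl
    rw [mul_comm π b]
    exact mul_dvd_mul_left b h2

section

variable {w : Fin n → ℕ}

theorem weightedHomogeneousComponent_mul_of_extremal {P Q : MvPolynomial (Fin n) ℂ} {a b : ℕ}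
    (h : ∀ i j, i + j = a + b → i ≠ a →
      MvPolynomial.weightedHomogeneousComponent w i P *
        MvPolynomial.weightedHomogeneousComponent w j Q = 0) :
    MvPolynomial.weightedHomogeneousComponent w (a + b) (P * Q) =
      MvPolynomial.weightedHomogeneousComponent w a P *
        MvPolynomial.weightedHomogeneousComponent w b Q := by
  rw [weightedHomogeneousComponent_mul, Finset.sum_eq_single (a, b)]
  · rintro ⟨i, j⟩ hij hne
    rw [Finset.HasAntidiagonal.mem_antidiagonal] at hij
    simp only at hij
    refine h i j hij fun hia => hne ?_
    rw [hia, show j = b by omega]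
  · simp

theorem exists_lowest_highest {P : MvPolynomial (Fin n) ℂ} (hP : P ≠ 0) :
    ∃ a A, MvPolynomial.weightedHomogeneousComponent w a P ≠ 0 ∧
      MvPolynomial.weightedHomogeneousComponent w A P ≠ 0 ∧
      (∀ k < a, MvPolynomial.weightedHomogeneousComponent w k P = 0) ∧
      (∀ k > A, MvPolynomial.weightedHomogeneousComponent w k P = 0) ∧ a ≤ A := by
  classical
  set s := P.support.image (Finsupp.weight w) with hs
  have hne : s.Nonempty := (MvPolynomial.support_nonempty.2 hP).image _
  have h0 : ∀ k, k ∉ s → MvPolynomial.weightedHomogeneousComponent w k P = 0 := by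
    intro k hk
    refine MvPolynomial.weightedHomogeneousComponent_eq_zero' k P fun b hb hbk => hk ?_
    exact Finset.mem_image.2 ⟨b, hb, hbk⟩
  have h1 : ∀ k ∈ s, MvPolynomial.weightedHomogeneousComponent w k P ≠ 0 := by
    intro k hk h
    obtain ⟨b, hb, rfl⟩ := Finset.mem_image.1 hk
    have := congrArg (MvPolynomial.coeff b) h
    rw [MvPolynomial.coeff_weightedHomogeneousComponent, if_pos rfl] at this
    exact MvPolynomial.mem_support_iff.1 hb this
  exact ⟨s.min' hne, s.max' hne, h1 _ (s.min'_mem hne), h1 _ (s.max'_mem hne),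
    fun k hk => h0 k fun hks => absurd (s.min'_le k hks) (not_le.2 hk),
    fun k hk => h0 k fun hks => absurd (s.le_max' k hks) (not_le.2 hk),
    s.min'_le_max' hne⟩

theorem isWeightedHomogeneous_of_forall_ne {P : MvPolynomial (Fin n) ℂ} {a : ℕ}
    (h : ∀ k ≠ a, MvPolynomial.weightedHomogeneousComponent w k P = 0) :
    P.IsWeightedHomogeneous w a := by
  classical
  intro b hb
  by_contra hne
  have := congrArg (MvPolynomial.coeff b) (h _ hne)
  rw [MvPolynomial.coeff_weightedHomogeneousComponent, if_pos rfl] at this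
  exact hb this

/-- A factor of a nonzero weighted homogeneous polynomial is weighted homogeneous. -/
theorem exists_isWeightedHomogeneous_of_dvd {P D : MvPolynomial (Fin n) ℂ} {e : ℕ} (hD : D ≠ 0)
    (hDe : D.IsWeightedHomogeneous w e) (h : P ∣ D) : ∃ k, P.IsWeightedHomogeneous w k := by
  obtain ⟨Q, rfl⟩ := h
  obtain ⟨a, A, ha, hA, hlow, hhigh, haA⟩ := exists_lowest_highest (w := w) (left_ne_zero_of_mul hD)
  obtain ⟨b, B, hb, hB, hlow', hhigh', hbB⟩ :=
    exists_lowest_highest (w := w) (right_ne_zero_of_mul hD)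
  -- The product of the lowest components is nonzero, and so is that of the highest ones. Both must
  -- sit in degree `e`; together with `a ≤ A` and `b ≤ B` this gives `a = A`.
  have h1 : a + b = e := by
    by_contra hne
    have := weightedHomogeneousComponent_mul_of_extremal (w := w) (P := P) (Q := Q) (a := a) (b := b)
      fun i j hij hi => by
        rcases lt_or_gt_of_ne hi with hlt | hlt
        · rw [hlow i hlt, zero_mul]
        · rw [hlow' j (by omega), mul_zero]
    rw [hDe.weightedHomogeneousComponent_ne _ hne] at this
    exact mul_ne_zero ha hb this.symm
  have h2 : A + B = e := by
    by_contra hne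
    have := weightedHomogeneousComponent_mul_of_extremal (w := w) (P := P) (Q := Q) (a := A) (b := B)
      fun i j hij hi => by
        rcases lt_or_gt_of_ne hi with hlt | hlt
        · rw [hhigh' j (by omega), mul_zero]
        · rw [hhigh i hlt, zero_mul]
    rw [hDe.weightedHomogeneousComponent_ne _ hne] at this
    exact mul_ne_zero hA hB this.symm
  have h3 : a = A := by omega
  refine ⟨a, isWeightedHomogeneous_of_forall_ne fun k hk => ?_⟩
  rcases lt_or_gt_of_ne hk with hlt | hlt
  · exact hlow k hlt
  · exact hhigh k (h3 ▸ hlt)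

theorem dvd_wcomp_of_ofPoly_dvd (hw : ∀ i, 0 < w i) {D : MvPolynomial (Fin n) ℂ} {e : ℕ}
    (hD : D.IsWeightedHomogeneous w e) {g : O n} (h : ofPoly D ∣ g) (k : ℕ) : D ∣ wcomp w k g := by
  obtain ⟨q, rfl⟩ := h
  rcases lt_or_ge k e with hk | hk
  · rw [wcomp_ofPoly_mul_of_lt hw hD hk]
    exact dvd_zero _
  · obtain ⟨k, rfl⟩ := Nat.exists_eq_add_of_le hk
    rw [wcomp_ofPoly_mul hw hD]
    exact dvd_mul_right _ _

theorem exists_lowest_not_dvd {D : MvPolynomial (Fin n) ℂ} {g : O n}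
    (h : ∃ k, ¬ D ∣ wcomp w k g) :
    ∃ k, ¬ D ∣ wcomp w k g ∧ ∀ j < k, D ∣ wcomp w j g := by
  classical
  exact ⟨Nat.find h, Nat.find_spec h, fun j hj => not_not.1 (Nat.find_min h hj)⟩

theorem ofPoly_mem_vanish_one_of_prime (hw : ∀ i, 0 < w i) {π : MvPolynomial (Fin n) ℂ} {e : ℕ}
    (hπe : π.IsWeightedHomogeneous w e) (hπ : Prime π) : ofPoly π ∈ vanish n 1 := by
  have h0 : MvPolynomial.weightedHomogeneousComponent w 0 π = 0 := by
    rcases Nat.eq_zero_or_pos e with rfl | he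
    · exfalso
      have h1 := hπe.weightedHomogeneousComponent_same
      rw [MvPolynomial.weightedHomogeneousComponent_zero _ fun i => (hw i).ne'] at h1
      rw [← h1] at hπ
      refine hπ.not_isUnit (IsUnit.map MvPolynomial.C (IsUnit.mk0 _ fun h => hπ.ne_zero ?_))
      rw [h, map_zero]
    · exact hπe.weightedHomogeneousComponent_ne _ he.ne
  rw [MvPolynomial.weightedHomogeneousComponent_zero _ fun i => (hw i).ne',
    MvPolynomial.C_eq_zero] at h0
  refine ofPoly_mem_vanish fun a ha => ?_
  rw [(Finsupp.degree_eq_zero_iff a).1 (by omega), h0]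

/-- A weighted homogeneous prime polynomial stays prime in the ring of germs. -/
theorem prime_ofPoly (hw : ∀ i, 0 < w i) {π : MvPolynomial (Fin n) ℂ} {e : ℕ}
    (hπe : π.IsWeightedHomogeneous w e) (hπ : Prime π) : Prime (ofPoly π) := by
  refine ⟨fun h => hπ.ne_zero (ofPoly_injective (by rw [h, map_zero])), fun hu => ?_,
    fun g g' h => ?_⟩
  · have := Ideal.eq_top_of_isUnit_mem _ (ofPoly_mem_vanish_one_of_prime hw hπe hπ) hu
    exact one_notMem_vanish_one (this ▸ Submodule.mem_top)
  · by_contra! hne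
    have key : ∀ g : O n, ¬ ofPoly π ∣ g → ∃ k, ¬ π ∣ wcomp w k g := fun g hg => by
      by_contra! hk
      exact hg (ofPoly_dvd_of_dvd_wcomp hw hπe hπ.ne_zero hk)
    obtain ⟨k, hk, hk'⟩ := exists_lowest_not_dvd (key g hne.1)
    obtain ⟨l, hl, hl'⟩ := exists_lowest_not_dvd (key g' hne.2)
    -- As in Gauss's lemma: `k` and `l` index the lowest components not divisible by `π`, so in
    -- degree `k + l` every product but theirs is divisible by `π`.
    have h1 := dvd_wcomp_of_ofPoly_dvd hw hπe h (k + l)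
    rw [wcomp_mul hw, ← Finset.add_sum_erase _ _ (a := (k, l))
      (Finset.HasAntidiagonal.mem_antidiagonal.2 rfl)] at h1
    have h2 : π ∣ ∑ ij ∈ (Finset.HasAntidiagonal.antidiagonal (k + l)).erase (k, l),
        wcomp w ij.1 g * wcomp w ij.2 g' := by
      refine Finset.dvd_sum fun ij hij => ?_
      obtain ⟨i, j⟩ := ij
      rw [Finset.mem_erase, Finset.HasAntidiagonal.mem_antidiagonal] at hij
      obtain ⟨hne, hij⟩ := hij
      simp only at hij
      rcases lt_trichotomy i k with h1 | h1 | h1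
      · exact (hk' i h1).mul_right _
      · exact absurd (by rw [h1, show j = l by omega]) hne
      · exact (hl' j (by omega)).mul_left _
    have h3 := (dvd_add_left h2).1 h1
    exact (hπ.dvd_or_dvd h3).elim hk hl

/-- For a prime `q` strictly inside `(π)`, each `x ∈ q` is `π y` with `y` again in `q`. Iterating,
`x` vanishes to every order, so `q = 0`. -/
theorem height_span_prime_le_one {π : O n} (hπ : Prime π) (hπv : π ∈ vanish n 1) :
    (Ideal.span {π}).height ≤ 1 := by
  have hprime : (Ideal.span {π}).IsPrime := (Ideal.span_singleton_prime hπ.ne_zero).2 hπ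
  refine (Ideal.height_le_iff (n := 1)).2 fun q hq hlt => ?_
  have hπq : π ∉ q := fun h => not_le_of_gt hlt ((Ideal.span_singleton_le_iff_mem _).2 h)
  have : ∀ N, ∀ x ∈ q, x ∈ vanish n N := by
    intro N
    induction N with
    | zero => intro x _; rw [vanish_zero]; trivial
    | succ N ih =>
      intro x hx
      obtain ⟨y, rfl⟩ := Ideal.mem_span_singleton.1 (hlt.le hx)
      have hy := (hq.mem_or_mem hx).resolve_left hπq
      rw [add_comm]
      exact mul_mem_vanish hπv (ih y hy)
  have hbot : q = ⊥ := by
    rw [eq_bot_iff]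
    exact fun x hx => eq_zero_of_mem_vanish fun N => this N x hx
  rw [hbot, Ideal.height_bot]
  exact_mod_cast one_pos

theorem pderiv_isWeightedHomogeneous {P : MvPolynomial (Fin n) ℂ} {d : ℕ}
    (hP : P.IsWeightedHomogeneous w d) (i : Fin n) :
    MvPolynomial.pderiv i P = 0 ∨
      ∃ k, k + w i = d ∧ (MvPolynomial.pderiv i P).IsWeightedHomogeneous w k := by
  rcases lt_or_ge d (w i) with h | h
  · refine Or.inl (MvPolynomial.pderiv_eq_zero_of_notMem_vars fun hi => ?_)
    obtain ⟨a, ha, hia⟩ := (MvPolynomial.mem_vars_iff_mem_support _).1 hi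
    have h1 := Finsupp.le_weight_of_ne_zero' (w := w) (Finsupp.mem_support_iff.1 hia)
    rw [hP (MvPolynomial.mem_support_iff.1 ha)] at h1
    omega
  · exact Or.inr ⟨d - w i, Nat.sub_add_cancel h, hP.pderiv (Nat.sub_add_cancel h)⟩

/-- The minors of the Jacobian matrix of weighted homogeneous polynomials are weighted
homogeneous. -/
theorem exists_isWeightedHomogeneous_det_pderiv {Q : Fin n → MvPolynomial (Fin n) ℂ}
    {d : Fin n → ℕ} (hQ : ∀ j, (Q j).IsWeightedHomogeneous w (d j)) :
    ∃ e, (Matrix.of fun j i => MvPolynomial.pderiv i (Q j)).det.IsWeightedHomogeneous w e := by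
  -- The truncated subtraction is harmless: a nonzero term of the determinant forces `∑ w ≤ ∑ d`,
  -- and the zero polynomial is homogeneous of every degree.
  refine ⟨∑ j, d j - ∑ i, w i, ?_⟩
  rw [Matrix.det_apply]
  refine MvPolynomial.IsWeightedHomogeneous.sum _ _ _ fun σ _ => ?_
  suffices h : (∏ i, MvPolynomial.pderiv i (Q (σ i))).IsWeightedHomogeneous w
      (∑ j, d j - ∑ i, w i) by
    have := h.C_mul (((Equiv.Perm.sign σ : ℤ) : ℂ))
    simpa [Units.smul_def, Matrix.of_apply, zsmul_eq_mul] using this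
  by_cases h0 : ∃ i, MvPolynomial.pderiv i (Q (σ i)) = 0
  · obtain ⟨i, hi⟩ := h0
    rw [Finset.prod_eq_zero (Finset.mem_univ i) hi]
    exact MvPolynomial.isWeightedHomogeneous_zero _ _ _
  · push Not at h0
    choose k hk hk' using fun i => (pderiv_isWeightedHomogeneous (hQ (σ i)) i).resolve_left (h0 i)
    have h1 := MvPolynomial.IsWeightedHomogeneous.prod Finset.univ
      (fun i => MvPolynomial.pderiv i (Q (σ i))) k fun i _ => hk' i
    have h2 : ∑ i, k i + ∑ i, w i = ∑ j, d j := by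
      rw [← Finset.sum_add_distrib, ← Equiv.sum_comp σ d]
      exact Finset.sum_congr rfl fun i _ => hk i
    rwa [show ∑ j, d j - ∑ i, w i = ∑ i, k i by omega]

end

/-- If `c` is a nonzero row vector killing the columns of `A`, and `c ⬝ᵥ v = 0`, then every
maximal minor multiple of `v` is in the column span of `A`. -/
theorem exists_mulVec_eq_det_smul {R : Type*} [CommRing R] [IsDomain R]
    {A : Matrix (Fin (n + 1)) (Fin n) R} {c v : Fin (n + 1) → R} (hc : c ≠ 0)
    (hcA : Matrix.vecMul c A = 0) (hcv : dotProduct c v = 0) (l : Fin (n + 1)) :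
    ∃ η : Fin n → R, A.mulVec η = (A.submatrix l.succAbove id).det • v := by
  -- The square matrix `[v | A]` is killed on the left by `c`, so its determinant is zero and `M *
  -- adjugate M = 0`. In column `l` of this identity the coefficient of `v` is, up to sign, the
  -- minor omitting row `l`.
  set M : Matrix (Fin (n + 1)) (Fin (n + 1)) R := Matrix.of fun j => Fin.cons (v j) (A j) with hM
  have hdet : M.det = 0 := by
    refine Matrix.exists_vecMul_eq_zero_iff.1 ⟨c, hc, ?_⟩
    ext i
    refine Fin.cases ?_ (fun i => ?_) i
    · simpa [hM, Matrix.vecMul, dotProduct] using hcv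
    · simpa [hM, Matrix.vecMul, dotProduct] using congrFun hcA i
  have hadj := M.mul_adjugate
  rw [hdet, zero_smul] at hadj
  have hsub : M.submatrix l.succAbove (Fin.succAbove 0) = A.submatrix l.succAbove id := by
    ext i j
    simp [hM]
  refine ⟨fun i => -(-1) ^ (l : ℕ) * M.adjugate i.succ l, ?_⟩
  ext j
  have h1 := congrFun (congrFun hadj j) l
  rw [Matrix.mul_apply, Fin.sum_univ_succ, Matrix.adjugate_fin_succ_eq_det_submatrix, hsub] at h1
  simp only [hM, Matrix.of_apply, Fin.cons_zero, Fin.cons_succ, Matrix.zero_apply, Fin.val_zero,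
    add_zero] at h1
  rw [← hM] at h1
  have h2 : ∑ i, A j i * M.adjugate i.succ l =
      -(v j * ((-1) ^ (l : ℕ) * (A.submatrix l.succAbove id).det)) := by
    rw [eq_neg_iff_add_eq_zero, add_comm]
    exact h1
  simp only [Matrix.mulVec, dotProduct, Pi.smul_apply, smul_eq_mul]
  calc _ = -(-1) ^ (l : ℕ) * ∑ i, A j i * M.adjugate i.succ l := by
        rw [Finset.mul_sum]
        refine Finset.sum_congr rfl fun i _ => ?_
        ring
    _ = ((-1) ^ (l : ℕ) * (-1) ^ (l : ℕ)) * ((A.submatrix l.succAbove id).det * v j) := by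
        rw [h2]; ring
    _ = _ := by rw [← mul_pow]; simp

/-- The minors of the Jacobian matrix of the polynomial model. -/
def Model.minor {f : MapGerm n (n + 1)} (m : Model f) (l : Fin (n + 1)) : MvPolynomial (Fin n) ℂ :=
  (Matrix.of fun j i => MvPolynomial.pderiv i (m.P (l.succAbove j))).det

theorem Model.det_submatrix {f : MapGerm n (n + 1)} (m : Model f) (l : Fin (n + 1)) :
    (f.jacobianMatrix.submatrix l.succAbove id).det = ofPoly (m.minor l) := by
  rw [Model.minor, AlgHom.map_det]
  congr 1
  ext j i
  simp [MapGerm.jacobianMatrix, m.comp_eq, pderiv_ofPoly]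

/-- If the ramification locus has codimension at least two, then the vector fields along `f` that
are killed by a nonzero covector killing the image of `tf` lie in the image of `tf`. -/
theorem Model.mem_range_mulVec {f : MapGerm n (n + 1)} (m : Model f)
    (hr : 2 ≤ f.ramificationCodim) {c v : Fin (n + 1) → O n} (hc : c ≠ 0)
    (hcA : Matrix.vecMul c f.jacobianMatrix = 0) (hcv : dotProduct c v = 0) :
    ∃ ξ, f.jacobianMatrix.mulVec ξ = v := by
  set A := f.jacobianMatrix with hA
  have hram : f.ramificationIdeal = Ideal.span (Set.range fun l => ofPoly (m.minor l)) := by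
    rw [MapGerm.ramificationIdeal]
    congr 2
    ext1 l
    exact m.det_submatrix l
  choose η hη using exists_mulVec_eq_det_smul hc hcA hcv
  simp only [hA, m.det_submatrix] at hη
  rw [← hA] at hη
  -- If all minors were zero, the ramification ideal would be zero, of height `0`. A nonzero minor
  -- makes `A` injective.
  obtain ⟨l₀, hl₀⟩ : ∃ l, m.minor l ≠ 0 := by
    by_contra! h0
    rw [MapGerm.ramificationCodim, hram] at hr
    have : Ideal.span (Set.range fun l => ofPoly (m.minor l)) = ⊥ := by
      rw [Ideal.span_eq_bot]
      rintro _ ⟨l, rfl⟩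
      simp [h0]
    rw [this, Ideal.height_bot] at hr
    exact absurd hr (by decide)
  have hD0 : ofPoly (m.minor l₀) ≠ 0 := fun h => hl₀ (ofPoly_injective (by rw [h, map_zero]))
  have hinj : ∀ y, A.mulVec y = 0 → y = 0 := by
    intro y hy
    refine Matrix.eq_zero_of_mulVec_eq_zero (M := A.submatrix l₀.succAbove id) ?_ ?_
    · rw [m.det_submatrix]
      exact hD0
    · ext j
      exact congrFun hy (l₀.succAbove j)
  have hhom : ∀ l, ∃ e, (m.minor l).IsWeightedHomogeneous m.w e := fun l =>
    exists_isWeightedHomogeneous_det_pderiv fun j => m.hom (l.succAbove j)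
  choose e he using hhom
  have hcross : ∀ l i, ofPoly (m.minor l) * η l₀ i = ofPoly (m.minor l₀) * η l i := by
    intro l i
    have h1 : A.mulVec (ofPoly (m.minor l) • η l₀ - ofPoly (m.minor l₀) • η l) = 0 := by
      rw [Matrix.mulVec_sub, Matrix.mulVec_smul, Matrix.mulVec_smul, hη, hη, smul_smul, smul_smul,
        mul_comm, sub_self]
    have h2 := congrFun (hinj _ h1) i
    simpa [sub_eq_zero] using h2
  -- A prime dividing all the minors is weighted homogeneous, being a factor of a nonzero
  -- homogeneous polynomial. It thus stays prime among germs and bounds the height of the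
  -- ramification ideal by one.
  have hnoprime : ∀ π, Prime π → π ∣ m.minor l₀ → ∃ l, ¬ π ∣ m.minor l := by
    intro π hπ hπl₀
    by_contra! hall
    obtain ⟨k, hk⟩ := exists_isWeightedHomogeneous_of_dvd hl₀ (he l₀) hπl₀
    have h1 : f.ramificationIdeal ≤ Ideal.span {ofPoly π} := by
      rw [hram, Ideal.span_le]
      rintro _ ⟨l, rfl⟩
      exact Ideal.mem_span_singleton.2 (map_dvd ofPoly (hall l))
    have h2 := hr.trans ((Ideal.height_mono h1).trans (height_span_prime_le_one
      (prime_ofPoly m.w_pos hk hπ) (ofPoly_mem_vanish_one_of_prime m.w_pos hk hπ)))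
    exact absurd h2 (by decide)
  have hdvd : ∀ i, ofPoly (m.minor l₀) ∣ η l₀ i := by
    intro i
    -- Divisibility is now a matter of single weighted components, where unique factorization of
    -- polynomials applies to the relations `hcross`.
    refine ofPoly_dvd_of_dvd_wcomp m.w_pos (he l₀) hl₀ fun k => ?_
    refine dvd_of_forall_dvd_mul hl₀ hnoprime fun l => ?_
    rw [← wcomp_ofPoly_mul m.w_pos (he l), hcross]
    exact dvd_wcomp_of_ofPoly_dvd m.w_pos (he l₀) (dvd_mul_right _ _) _
  choose ξ hξ using hdvd
  refine ⟨ξ, ?_⟩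
  have h1 : η l₀ = ofPoly (m.minor l₀) • ξ := funext fun i => hξ i
  have h2 := hη l₀
  rw [h1, Matrix.mulVec_smul] at h2
  exact smul_right_injective _ hD0 h2

end

/-! ### Dedekind's conductor: trace duality for a monogenic extension -/

section

open Polynomial in
/-- If `S` is a birational integral extension of `A[x]`, with `A` integrally closed, then the
derivative of the minimal polynomial of `x` conducts `S` into `A[x]`. -/
theorem exists_aeval_derivative_minpoly_mul {A S : Type*} [CommRing A] [IsDomain A]
    [IsIntegrallyClosed A] [CharZero A] [CommRing S] [IsDomain S] [Algebra A S] [FaithfulSMul A S]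
    [Algebra.IsIntegral A S] {x : S}
    (hbir : ∀ s, ∃ a b : A[X], aeval x b ≠ 0 ∧ aeval x b * s = aeval x a) (s : S) :
    ∃ a : A[X], aeval x (derivative (minpoly A x)) * s = aeval x a := by
  let K := FractionRing A
  let L := FractionRing S
  let : Algebra K L := FractionRing.liftAlgebra A L
  have : IsScalarTower A K L := FractionRing.isScalarTower_liftAlgebra A L
  have : CharZero K := charZero_of_injective_algebraMap (IsFractionRing.injective A K)
  have hSL : Function.Injective (algebraMap S L) := IsFractionRing.injective S L
  have : Algebra.IsAlgebraic K L := inferInstance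
  set X : L := algebraMap S L x with hX
  have hxA : IsIntegral A x := Algebra.IsIntegral.isIntegral x
  have hXA : IsIntegral A X := hxA.map (IsScalarTower.toAlgHom A S L)
  have hXK : IsIntegral K X := hXA.tower_top
  -- Birationality says that `S` and `A[x]` have the same fractions, so `x` generates `L` over `K`.
  have htop : IntermediateField.adjoin K {X} = ⊤ := by
    rw [eq_top_iff]
    intro y _
    have hpoly : ∀ a : A[X], algebraMap S L (aeval x a) ∈ IntermediateField.adjoin K {X} := by
      intro a
      rw [← aeval_algebraMap_apply, ← aeval_map_algebraMap K, ← hX]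
      have h1 : aeval X (a.map (algebraMap A K)) ∈ Algebra.adjoin K {X} :=
        aeval_mem_adjoin_singleton _ _
      exact IntermediateField.algebra_adjoin_le_adjoin _ _ h1
    have hS : ∀ t : S, algebraMap S L t ∈ IntermediateField.adjoin K {X} := by
      intro t
      obtain ⟨a, b, hb, hab⟩ := hbir t
      have hb' : algebraMap S L (aeval x b) ≠ 0 := fun h =>
        hb (hSL (by rw [h, map_zero]))
      have : algebraMap S L t = algebraMap S L (aeval x a) / algebraMap S L (aeval x b) := by
        rw [eq_div_iff hb', ← map_mul, mul_comm, hab]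
      rw [this]
      exact div_mem (hpoly a) (hpoly b)
    obtain ⟨t, u, _, rfl⟩ := IsFractionRing.div_surjective (A := S) y
    exact div_mem (hS t) (hS u)
  have hadj : Algebra.adjoin K {X} = ⊤ := by
    rw [← IntermediateField.adjoin_simple_toSubalgebra_of_isAlgebraic hXK.isAlgebraic, htop,
      IntermediateField.top_toSubalgebra]
  have : FiniteDimensional K L := by
    have h1 := IntermediateField.adjoin.finiteDimensional hXK
    rw [htop] at h1
    exact Module.Finite.equiv (IntermediateField.topEquiv (F := K) (E := L)).toLinearEquiv
  -- Euler's formula: the trace dual of `A[x]` is `A[x]` divided by the derivative of the minimal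
  -- polynomial at `x`.
  have hdual := traceForm_dualSubmodule_adjoin A K hadj hXA
  -- Products of `s` with elements of `A[x]` are integral over `A`, so their traces lie in the
  -- integrally closed ring `A`.
  have hs : algebraMap S L s ∈ (Algebra.traceForm K L).dualSubmodule
      (Subalgebra.toSubmodule (Algebra.adjoin A {X})) := by
    rw [LinearMap.BilinForm.mem_dualSubmodule]
    intro y hy
    rw [Subalgebra.mem_toSubmodule, Algebra.adjoin_singleton_eq_range_aeval] at hy
    obtain ⟨a, rfl⟩ := hy
    rw [Algebra.traceForm_apply]
    have h1 : IsIntegral A (algebraMap S L s * aeval X a) := by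
      rw [hX, aeval_algebraMap_apply, ← map_mul]
      exact (Algebra.IsIntegral.isIntegral (R := A) (s * aeval x a)).map (IsScalarTower.toAlgHom A S L)
    obtain ⟨z, hz⟩ := IsIntegrallyClosed.isIntegral_iff.1 (Algebra.isIntegral_trace (L := K) h1)
    rw [Submodule.mem_one]
    exact ⟨z, hz⟩
  rw [hdual] at hs
  obtain ⟨y, hy, hys⟩ := hs
  rw [SetLike.mem_coe, Subalgebra.mem_toSubmodule, Algebra.adjoin_singleton_eq_range_aeval] at hy
  obtain ⟨a, rfl⟩ := hy
  have hmin : aeval X (derivative (minpoly K X)) =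
      algebraMap S L (aeval x (derivative (minpoly A x))) := by
    rw [hX, minpoly.isIntegrallyClosed_eq_field_fractions K L hxA, derivative_map,
      aeval_map_algebraMap, aeval_algebraMap_apply]
  rw [hmin] at hys
  by_cases h0 : aeval x (derivative (minpoly A x)) = 0
  · exact ⟨0, by rw [h0, zero_mul, map_zero]⟩
  · have h0' : algebraMap S L (aeval x (derivative (minpoly A x))) ≠ 0 := fun h =>
      h0 (hSL (by rw [h, map_zero]))
    refine ⟨a, hSL ?_⟩
    rw [map_mul, ← hys]
    change _ * (_⁻¹ * aeval X a) = _
    rw [mul_inv_cancel_left₀ h0', hX, aeval_algebraMap_apply]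

open Polynomial in
/-- The same for a monic polynomial `F` generating the kernel of `A[X] → S`, and in terms of ring
homomorphisms. -/
theorem exists_eval₂_derivative_mul {A S : Type*} [CommRing A] [IsDomain A]
    [IsIntegrallyClosed A] [CharZero A] [CommRing S] [IsDomain S] (i : A →+* S) (x : S)
    {F : A[X]} (hF : F.Monic) (hker : ∀ G : A[X], G.eval₂ i x = 0 ↔ F ∣ G)
    (hint : ∀ s, (eval₂RingHom i x).IsIntegralElem s)
    (hbir : ∀ s, ∃ a b : A[X], b.eval₂ i x ≠ 0 ∧ b.eval₂ i x * s = a.eval₂ i x) (s : S) :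
    ∃ a : A[X], (derivative F).eval₂ i x * s = a.eval₂ i x := by
  let : Algebra A S := i.toAlgebra
  have hae : ∀ G : A[X], aeval x G = G.eval₂ i x := fun G => rfl
  have hFx : aeval x F = 0 := (hker F).2 dvd_rfl
  have hinj : Function.Injective i := by
    rw [injective_iff_map_eq_zero]
    intro a ha
    -- A nonzero constant divisible by `F` would force the monic `F` to be `1`, against `F(x) = 0`.
    have h1 : F ∣ C a := by rw [← hker, eval₂_C, ha]
    by_contra hne
    have h2 := natDegree_le_of_dvd h1 (C_ne_zero.2 hne)
    rw [natDegree_C, Nat.le_zero] at h2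
    rw [hF.natDegree_eq_zero.1 h2] at hFx
    simp at hFx
  have : FaithfulSMul A S := (faithfulSMul_iff_algebraMap_injective A S).2 hinj
  have hx : IsIntegral A x := ⟨F, hF, hFx⟩
  -- Transitivity: `S` is integral over the image of `A[X]`, which lies in the integral closure of
  -- `A` because `x` is a root of the monic `F`.
  have : Algebra.IsIntegral A S := by
    refine ⟨fun t => ?_⟩
    have hmem : ∀ a : A[X], aeval x a ∈ integralClosure A S := fun a => by
      have h1 := Subalgebra.aeval_coe (integralClosure A S) ⟨x, hx⟩ a
      rw [h1]
      exact (aeval (⟨x, hx⟩ : integralClosure A S) a).2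
    let j : A[X] →ₐ[A] integralClosure A S := (aeval x).codRestrict _ hmem
    obtain ⟨G, hG, hGt⟩ := hint t
    have h1 : IsIntegral (integralClosure A S) t := by
      refine ⟨G.map (j : A[X] →+* integralClosure A S), hG.map _, ?_⟩
      rw [eval₂_map]
      exact hGt
    exact isIntegral_trans t h1
  have hmin : minpoly A x = F := by
    have h1 : minpoly A x ∣ F := minpoly.isIntegrallyClosed_dvd hx hFx
    have h2 : F ∣ minpoly A x := (hker _).1 (minpoly.aeval A x)
    exact eq_of_monic_of_associated (minpoly.monic hx) hF (associated_of_dvd_dvd h1 h2)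
  have := exists_aeval_derivative_minpoly_mul (A := A) (x := x) hbir s
  rwa [hmin] at this

open Polynomial in
theorem exists_map_derivative_mul {A S : Type*} [CommRing A] [IsDomain A]
    [IsIntegrallyClosed A] [CharZero A] [CommRing S] [IsDomain S] (ψ : A[X] →+* S)
    {F : A[X]} (hF : F.Monic) (hker : ∀ G : A[X], ψ G = 0 ↔ F ∣ G)
    (hint : ∀ s, ψ.IsIntegralElem s) (hbir : ∀ s, ∃ a b : A[X], ψ b ≠ 0 ∧ ψ b * s = ψ a) (s : S) :
    ∃ a : A[X], ψ (derivative F) * s = ψ a := by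
  have h : eval₂RingHom (ψ.comp C) (ψ X) = ψ := by
    ext <;> simp
  have h' : ∀ G : A[X], G.eval₂ (ψ.comp C) (ψ X) = ψ G := fun G => RingHom.congr_fun h G
  have := exists_eval₂_derivative_mul (ψ.comp C) (ψ X) hF (by simpa only [h'] using hker)
    (by rwa [h]) (by simpa only [h'] using hbir) s
  simpa only [h'] using this

end

/-! ### General linear coordinates and the Jacobian ideal of an affine hypersurface -/

section

variable {n : ℕ}

/-- The coordinate change `y_0 ↦ X`, `y_{i+1} ↦ y_i + c_i X` to polynomials in one variable. -/
def shear (c : Fin n → ℂ) :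
    MvPolynomial (Fin (n + 1)) ℂ →ₐ[ℂ] Polynomial (MvPolynomial (Fin n) ℂ) :=
  MvPolynomial.aeval (Fin.cons Polynomial.X fun i =>
    Polynomial.C (MvPolynomial.X i) + Polynomial.C (MvPolynomial.C (c i)) * Polynomial.X)

/-- The inverse of `shear c`. -/
def unshear (c : Fin n → ℂ) :
    Polynomial (MvPolynomial (Fin n) ℂ) →+* MvPolynomial (Fin (n + 1)) ℂ :=
  Polynomial.eval₂RingHom
    (MvPolynomial.aeval fun i : Fin n => (MvPolynomial.X i.succ - MvPolynomial.C (c i) *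
      MvPolynomial.X 0 : MvPolynomial (Fin (n + 1)) ℂ)).toRingHom
    (MvPolynomial.X 0)

theorem shear_C (c : Fin n → ℂ) (r : ℂ) :
    shear c (MvPolynomial.C r) = Polynomial.C (MvPolynomial.C r) := by
  rw [shear, MvPolynomial.aeval_C]
  rfl

theorem shear_X_zero (c : Fin n → ℂ) : shear c (MvPolynomial.X 0) = Polynomial.X := by
  simp [shear]

theorem shear_X_succ (c : Fin n → ℂ) (i : Fin n) : shear c (MvPolynomial.X i.succ) =
    Polynomial.C (MvPolynomial.X i) + Polynomial.C (MvPolynomial.C (c i)) * Polynomial.X := by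
  simp [shear]

theorem unshear_shear (c : Fin n → ℂ) (a : MvPolynomial (Fin (n + 1)) ℂ) :
    unshear c (shear c a) = a := by
  have : (unshear c).comp (shear c).toRingHom = RingHom.id _ := by
    refine MvPolynomial.ringHom_ext (fun r => ?_) fun j => ?_
    · change unshear c (shear c (MvPolynomial.C r)) = _
      rw [shear_C]
      simp [unshear]
    · change unshear c (shear c (MvPolynomial.X j)) = _
      refine Fin.cases ?_ (fun i => ?_) j
      · rw [shear_X_zero]
        simp [unshear]
      · rw [shear_X_succ]
        simp [unshear]
  exact RingHom.congr_fun this a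

theorem shear_unshear (c : Fin n → ℂ) (G : Polynomial (MvPolynomial (Fin n) ℂ)) :
    shear c (unshear c G) = G := by
  have : (shear c).toRingHom.comp (unshear c) = RingHom.id _ := by
    refine Polynomial.ringHom_ext' (MvPolynomial.ringHom_ext (fun r => ?_) fun i => ?_) ?_
    · change shear c (unshear c (Polynomial.C (MvPolynomial.C r))) = _
      simp [unshear, ← MvPolynomial.algebraMap_eq, Polynomial.algebraMap_apply]
    · change shear c (unshear c (Polynomial.C (MvPolynomial.X i))) = _
      simp [unshear, shear_X_succ, shear_X_zero]
    · change shear c (unshear c Polynomial.X) = _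
      simp [unshear, shear_X_zero]
  exact RingHom.congr_fun this G

theorem natDegree_shear_X_le (c : Fin n → ℂ) (j : Fin (n + 1)) :
    (shear c (MvPolynomial.X j)).natDegree ≤ 1 := by
  refine Fin.cases ?_ (fun i => ?_) j
  · rw [shear_X_zero]
    exact Polynomial.natDegree_X_le
  · rw [shear_X_succ]
    compute_degree

theorem coeff_one_shear_X (c : Fin n → ℂ) (j : Fin (n + 1)) :
    (shear c (MvPolynomial.X j)).coeff 1 =
      MvPolynomial.C ((Fin.cons 1 c : Fin (n + 1) → ℂ) j) := by
  refine Fin.cases ?_ (fun i => ?_) j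
  · rw [shear_X_zero]
    simp
  · rw [shear_X_succ]
    simp [Polynomial.coeff_C]

theorem natDegree_shear_monomial_le (c : Fin n → ℂ) (b : Fin (n + 1) →₀ ℕ) (r : ℂ) :
    (shear c (MvPolynomial.monomial b r)).natDegree ≤ b.degree ∧
      (shear c (MvPolynomial.monomial b r)).coeff b.degree =
        MvPolynomial.C (MvPolynomial.eval (Fin.cons 1 c) (MvPolynomial.monomial b r)) := by
  obtain ⟨v, hv⟩ := exists_word b.degree b rfl
  have h1 : MvPolynomial.monomial b r = MvPolynomial.C r * ∏ l, MvPolynomial.X (v l) := by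
    rw [hv, MvPolynomial.C_mul_monomial, mul_one]
  have h2 : (∏ l, shear c (MvPolynomial.X (v l))).natDegree ≤ b.degree := by
    refine (Polynomial.natDegree_prod_le _ _).trans ?_
    refine (Finset.sum_le_sum fun l _ => natDegree_shear_X_le c (v l)).trans ?_
    simp
  have h3 := Polynomial.coeff_prod_of_natDegree_le Finset.univ
    (fun l => shear c (MvPolynomial.X (v l))) 1 fun l _ => natDegree_shear_X_le c (v l)
  rw [Finset.card_univ, Fintype.card_fin, mul_one] at h3
  rw [h1, map_mul, shear_C, map_prod]
  refine ⟨(Polynomial.natDegree_C_mul_le _ _).trans h2, ?_⟩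
  rw [Polynomial.coeff_C_mul, h3]
  simp [coeff_one_shear_X]

theorem natDegree_shear_le (c : Fin n → ℂ) (H : MvPolynomial (Fin (n + 1)) ℂ) :
    (shear c H).natDegree ≤ H.totalDegree := by
  conv_lhs => rw [H.as_sum, map_sum]
  refine Polynomial.natDegree_sum_le_of_forall_le _ _ fun b hb => ?_
  exact (natDegree_shear_monomial_le c b _).1.trans (MvPolynomial.le_totalDegree hb)

/-- The top coefficient in `X` is a constant, the value of the leading form of `H` at `(1, c)`.
Where this is nonzero, `H` becomes monic after division by it. -/
theorem coeff_shear (c : Fin n → ℂ) (H : MvPolynomial (Fin (n + 1)) ℂ) :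
    (shear c H).coeff H.totalDegree = MvPolynomial.C (MvPolynomial.eval (Fin.cons 1 c)
      (MvPolynomial.homogeneousComponent H.totalDegree H)) := by
  classical
  conv_lhs => rw [H.as_sum, map_sum, Polynomial.finsetSum_coeff]
  rw [MvPolynomial.homogeneousComponent_apply, map_sum, map_sum, Finset.sum_filter]
  refine Finset.sum_congr rfl fun b hb => ?_
  rw [← H.as_sum]
  split_ifs with h
  · have := (natDegree_shear_monomial_le c b (H.coeff b)).2
    rwa [h] at this
  · refine Polynomial.coeff_eq_zero_of_natDegree_lt
      ((natDegree_shear_monomial_le c b _).1.trans_lt ?_)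
    exact lt_of_le_of_ne (MvPolynomial.le_totalDegree hb) h

/-- The derivative of a polynomial in the direction `v`. -/
def dirDeriv (v : Fin n → ℂ) (a : MvPolynomial (Fin n) ℂ) : MvPolynomial (Fin n) ℂ :=
  ∑ j, MvPolynomial.C (v j) * MvPolynomial.pderiv j a

theorem dirDeriv_mul_X (v : Fin n → ℂ) (a : MvPolynomial (Fin n) ℂ) (j : Fin n) :
    dirDeriv v (a * MvPolynomial.X j) = dirDeriv v a * MvPolynomial.X j +
      a * MvPolynomial.C (v j) := by
  have h : a * MvPolynomial.C (v j) =
      ∑ k, a * (MvPolynomial.C (v k) * Pi.single (M := fun _ => MvPolynomial (Fin n) ℂ) k 1 j) := by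
    rw [Finset.sum_eq_single j] <;> simp +contextual [eq_comm]
  rw [h, dirDeriv, dirDeriv, Finset.sum_mul, ← Finset.sum_add_distrib]
  refine Finset.sum_congr rfl fun k _ => ?_
  rw [Derivation.leibniz, MvPolynomial.pderiv_X, smul_eq_mul, smul_eq_mul]
  ring

theorem derivative_shear_X (c : Fin n → ℂ) (j : Fin (n + 1)) :
    Polynomial.derivative (shear c (MvPolynomial.X j)) =
      Polynomial.C (MvPolynomial.C ((Fin.cons 1 c : Fin (n + 1) → ℂ) j)) := by
  refine Fin.cases ?_ (fun i => ?_) j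
  · rw [shear_X_zero]
    simp
  · rw [shear_X_succ, Polynomial.derivative_add, Polynomial.derivative_C,
      Polynomial.derivative_C_mul, Polynomial.derivative_X, zero_add, mul_one, Fin.cons_succ]

/-- The new variable runs along the direction `(1, c)`. The element that conducts in the monogenic
situation is therefore a directional derivative of `H`. -/
theorem derivative_shear (c : Fin n → ℂ) (a : MvPolynomial (Fin (n + 1)) ℂ) :
    Polynomial.derivative (shear c a) = shear c (dirDeriv (Fin.cons 1 c) a) := by
  induction a using MvPolynomial.induction_on with
  | C r =>
    rw [shear_C, Polynomial.derivative_C]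
    simp [dirDeriv]
  | add p q hp hq =>
    rw [map_add, Polynomial.derivative_add, hp, hq, ← map_add]
    simp [dirDeriv, mul_add, Finset.sum_add_distrib]
  | mul_X p j hp =>
    rw [map_mul, Polynomial.derivative_mul, hp, dirDeriv_mul_X, map_add, map_mul, map_mul, shear_C,
      derivative_shear_X]

section

variable {S : Type*} [CommRing S] [IsDomain S] [Algebra ℂ S]
  {φ : MvPolynomial (Fin (n + 1)) ℂ →ₐ[ℂ] S} {H : MvPolynomial (Fin (n + 1)) ℂ}

theorem exists_map_dirDeriv_mul (hker : ∀ a, φ a = 0 ↔ H ∣ a)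
    (hint : ∀ s, (φ : MvPolynomial (Fin (n + 1)) ℂ →+* S).IsIntegralElem s)
    (hbir : ∀ s, ∃ a b, φ b ≠ 0 ∧ φ b * s = φ a) {c : Fin n → ℂ}
    (hc : MvPolynomial.eval (Fin.cons 1 c)
      (MvPolynomial.homogeneousComponent H.totalDegree H) ≠ 0) (s : S) :
    ∃ a, φ (dirDeriv (Fin.cons 1 c) H) * s = φ a := by
  set lam := MvPolynomial.eval (Fin.cons 1 c)
      (MvPolynomial.homogeneousComponent H.totalDegree H) with hlam
  set ψ : Polynomial (MvPolynomial (Fin n) ℂ) →+* S :=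
    (φ : MvPolynomial (Fin (n + 1)) ℂ →+* S).comp (unshear c) with hψ
  have hψs : ∀ a, ψ (shear c a) = φ a := fun a => by
    change φ (unshear c (shear c a)) = _
    rw [unshear_shear]
  set F : Polynomial (MvPolynomial (Fin n) ℂ) :=
    shear c (MvPolynomial.C lam⁻¹ * H) with hF
  have hFmonic : F.Monic := by
    refine Polynomial.monic_of_natDegree_le_of_coeff_eq_one H.totalDegree ?_ ?_
    · rw [hF, map_mul, shear_C]
      exact (Polynomial.natDegree_C_mul_le _ _).trans (natDegree_shear_le c H)
    · rw [hF, map_mul, shear_C, Polynomial.coeff_C_mul, coeff_shear, ← map_mul,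
        inv_mul_cancel₀ hc, map_one]
  have hunit : IsUnit (MvPolynomial.C lam⁻¹ : MvPolynomial (Fin (n + 1)) ℂ) :=
    (IsUnit.mk0 _ (inv_ne_zero hc)).map MvPolynomial.C
  have hkerF : ∀ G, ψ G = 0 ↔ F ∣ G := by
    intro G
    change φ (unshear c G) = 0 ↔ _
    rw [hker]
    constructor
    · intro h
      have := map_dvd (shear c) (hunit.mul_left_dvd.2 h)
      rwa [shear_unshear] at this
    · intro h
      have := map_dvd (unshear c) h
      rw [hF, unshear_shear] at this
      exact hunit.mul_left_dvd.1 this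
  have hintF : ∀ t, ψ.IsIntegralElem t := by
    intro t
    obtain ⟨P, hP, hPt⟩ := hint t
    refine ⟨P.map (shear c).toRingHom, hP.map _, ?_⟩
    rw [Polynomial.eval₂_map]
    have : ψ.comp (shear c).toRingHom = φ := RingHom.ext hψs
    rw [this]
    exact hPt
  have hbirF : ∀ t, ∃ a b, ψ b ≠ 0 ∧ ψ b * t = ψ a := by
    intro t
    obtain ⟨a, b, hb, hab⟩ := hbir t
    exact ⟨shear c a, shear c b, by rwa [hψs], by rw [hψs, hψs, hab]⟩
  obtain ⟨a, ha⟩ := exists_map_derivative_mul ψ hFmonic hkerF hintF hbirF s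
  refine ⟨MvPolynomial.C lam * unshear c a, ?_⟩
  have h1 : Polynomial.derivative F = shear c (MvPolynomial.C lam⁻¹ *
      dirDeriv (Fin.cons 1 c) H) := by
    rw [hF, map_mul, shear_C, Polynomial.derivative_C_mul, derivative_shear, map_mul, shear_C]
  rw [h1, hψs, map_mul] at ha
  have h2 : φ (MvPolynomial.C lam) * φ (MvPolynomial.C lam⁻¹) = 1 := by
    rw [← map_mul, ← map_mul, mul_inv_cancel₀ hc, map_one, map_one]
  change _ = φ (unshear c a) at ha
  rw [map_mul, ← ha, mul_assoc, ← mul_assoc, h2, one_mul]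

/-- The Jacobian ideal of an affine hypersurface conducts every birational integral extension of
its coordinate ring into the coordinate ring. -/
theorem exists_map_pderiv_mul (hH : H ≠ 0) (hker : ∀ a, φ a = 0 ↔ H ∣ a)
    (hint : ∀ s, (φ : MvPolynomial (Fin (n + 1)) ℂ →+* S).IsIntegralElem s)
    (hbir : ∀ s, ∃ a b, φ b ≠ 0 ∧ φ b * s = φ a) (j : Fin (n + 1)) (s : S) :
    ∃ a, φ (MvPolynomial.pderiv j H) * s = φ a := by
  set Λ := MvPolynomial.homogeneousComponent H.totalDegree H with hΛ
  have hΛ0 : Λ ≠ 0 := by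
    obtain ⟨b, hb, hbd⟩ : ∃ b ∈ H.support, b.degree = H.totalDegree := by
      obtain ⟨b, hb, h⟩ := Finset.exists_mem_eq_sup H.support (MvPolynomial.support_nonempty.2 hH)
        fun b => b.sum fun _ e => e
      exact ⟨b, hb, h.symm⟩
    intro h
    have := congrArg (MvPolynomial.coeff b) h
    rw [hΛ, MvPolynomial.coeff_homogeneousComponent, if_pos hbd] at this
    exact MvPolynomial.mem_support_iff.1 hb this
  -- The directions whose derivative of `H` multiplies `s` into the image of `φ` form a linear
  -- space, so it suffices that general directions belong to it.
  let V : Submodule ℂ (Fin (n + 1) → ℂ) :=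
    { carrier := {v | ∃ a, φ (dirDeriv v H) * s = φ a}
      zero_mem' := ⟨0, by simp [dirDeriv]⟩
      add_mem' := by
        rintro v v' ⟨a, ha⟩ ⟨a', ha'⟩
        refine ⟨a + a', ?_⟩
        rw [map_add, ← ha, ← ha', ← add_mul, ← map_add]
        simp [dirDeriv, add_mul, Finset.sum_add_distrib]
      smul_mem' := by
        rintro t v ⟨a, ha⟩
        refine ⟨MvPolynomial.C t * a, ?_⟩
        rw [map_mul, ← ha, ← mul_assoc, ← map_mul]
        simp [dirDeriv, Finset.mul_sum, mul_assoc] }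
  -- Directions with `v 0 ≠ 0` are rescaled to the form `(1, c)`; homogeneity of the leading form
  -- `Λ` transports its nonvanishing.
  have hV : ∀ v, MvPolynomial.eval v (Λ * MvPolynomial.X 0) ≠ 0 → v ∈ V := by
    intro v hv
    rw [map_mul, MvPolynomial.eval_X] at hv
    have hv0 : v 0 ≠ 0 := right_ne_zero_of_mul hv
    have hv' : v = v 0 • (Fin.cons 1 fun i => (v 0)⁻¹ * v i.succ : Fin (n + 1) → ℂ) := by
      ext k
      refine Fin.cases ?_ (fun i => ?_) k
      · simp
      · simp [mul_inv_cancel_left₀ hv0]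
    have hΛv := left_ne_zero_of_mul hv
    rw [hv']
    refine V.smul_mem _ (exists_map_dirDeriv_mul hker hint hbir ?_ s)
    intro h0
    apply hΛv
    have h1 := eval_weighted_smul (MvPolynomial.homogeneousComponent_isHomogeneous H.totalDegree H)
      (v 0) (Fin.cons 1 fun i => (v 0)⁻¹ * v i.succ)
    rw [h0, mul_zero] at h1
    rw [hv', ← h1]
    congr 2
    ext k
    simp
  have htop : V = ⊤ := by
    by_contra hne
    -- A proper subspace lies in the kernel of some `ℓ ≠ 0`; then `Λ * X 0 * ℓ` would vanish
    -- everywhere although none of its factors is the zero polynomial.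
    obtain ⟨ℓ, hℓ, hle⟩ := V.exists_le_ker_of_lt_top (lt_top_iff_ne_top.2 hne)
    set Lp : MvPolynomial (Fin (n + 1)) ℂ :=
      ∑ k, MvPolynomial.C (ℓ (Pi.single k 1)) * MvPolynomial.X k with hLp
    have hLv : ∀ v, MvPolynomial.eval v Lp = ℓ v := by
      intro v
      conv_rhs => rw [pi_eq_sum_univ' v, map_sum]
      rw [hLp, map_sum]
      refine Finset.sum_congr rfl fun k _ => ?_
      simp [mul_comm]
    have hL0 : Lp ≠ 0 := by
      intro h
      refine hℓ (LinearMap.ext fun v => ?_)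
      rw [← hLv, h, map_zero, LinearMap.zero_apply]
    refine mul_ne_zero (mul_ne_zero hΛ0 (MvPolynomial.X_ne_zero 0)) hL0 ?_
    refine MvPolynomial.funext fun v => ?_
    rw [map_mul, map_zero]
    by_cases hv : MvPolynomial.eval v (Λ * MvPolynomial.X 0) = 0
    · rw [hv, zero_mul]
    · rw [hLv, LinearMap.mem_ker.1 (hle (hV v hv)), mul_zero]
  have hj : (Pi.single j 1 : Fin (n + 1) → ℂ) ∈ V := htop ▸ Submodule.mem_top
  obtain ⟨a, ha⟩ := hj
  refine ⟨a, ?_⟩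
  rw [← ha, dirDeriv, Finset.sum_eq_single j]
  · simp
  · intro k _ hk
    rw [Pi.single_eq_of_ne hk, map_zero, zero_mul]
  · simp

end

end

/-! ### From polynomials to germs: integrality, birationality and Nakayama -/

section

variable {n p : ℕ}

theorem ofPoly_mem_vanish_one_of_pos {w : Fin n → ℕ} {a : MvPolynomial (Fin n) ℂ} {k : ℕ}
    (ha : a.IsWeightedHomogeneous w k) (hk : 0 < k) : ofPoly a ∈ vanish n 1 := by
  refine ofPoly_mem_vanish fun b hb => ?_
  refine ha.coeff_eq_zero b ?_
  rw [(Finsupp.degree_eq_zero_iff b).1 (by omega), map_zero]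
  exact hk.ne

namespace Model

variable {f : MapGerm n p} (m : Model f)

/-- A homogeneous integral equation of a coordinate over the target of a finite map-germ. -/
theorem exists_integral_equation (hfin : f.IsFinite) (i : Fin n) :
    ∃ (N : ℕ) (a : ℕ → MvPolynomial (Fin p) ℂ), (∀ k < N, ofPoly (a k) ∈ vanish p 1) ∧
      MvPolynomial.X i ^ N + ∑ k ∈ Finset.range N, m.φ (a k) * MvPolynomial.X i ^ k = 0 := by
  have hfin' : Module.Finite (O p) f.PushForward := hfin
  obtain ⟨G, hG, hGx⟩ := IsIntegral.of_finite (O p) (show f.PushForward from coord i)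
  replace hGx : G.eval₂ (f.pullback : O p →+* O n) (coord i) = 0 := hGx
  set N := G.natDegree with hN
  -- The part of weighted degree `N * w i` of an integral equation is again an equation. For `k < N`
  -- its coefficients have positive degree, hence no constant term.
  refine ⟨N, fun k => wcomp m.d ((N - k) * m.w i) (G.coeff k), fun k hk => ?_, ?_⟩
  · exact ofPoly_mem_vanish_one_of_pos (wcomp_isWeightedHomogeneous _ _ _)
      (Nat.mul_pos (by omega) (m.w_pos i))
  · rw [Polynomial.eval₂_eq_sum_range] at hGx
    have h1 := congrArg (wcomp m.w (N * m.w i)) hGx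
    rw [wcomp_zero m.w_pos, wcomp_sum m.w_pos] at h1
    have hterm : ∀ k ∈ Finset.range (N + 1),
        wcomp m.w (N * m.w i) ((f.pullback : O p →+* O n) (G.coeff k) * coord i ^ k) =
          m.φ (wcomp m.d ((N - k) * m.w i) (G.coeff k)) * MvPolynomial.X i ^ k := by
      intro k hk
      have hkN : k ≤ N := Nat.lt_succ_iff.1 (Finset.mem_range.1 hk)
      have hX : (MvPolynomial.X i ^ k : MvPolynomial (Fin n) ℂ).IsWeightedHomogeneous m.w
          (k * m.w i) := (MvPolynomial.isWeightedHomogeneous_X ℂ m.w i).pow k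
      have h2 := wcomp_ofPoly_mul m.w_pos hX ((N - k) * m.w i) (f.pullback (G.coeff k))
      rw [← add_mul, Nat.add_sub_cancel' hkN, m.wcomp_pullback, map_pow, ofPoly_X] at h2
      have h3 : (f.pullback : O p →+* O n) (G.coeff k) * coord i ^ k =
          coord i ^ k * f.pullback (G.coeff k) := mul_comm _ _
      rw [h3, mul_comm (m.φ _)]
      exact h2
    rw [Finset.sum_congr rfl hterm, Finset.sum_range_succ, Nat.sub_self, zero_mul,
      hG.coeff_natDegree] at h1
    have h3 : wcomp m.d 0 (1 : O p) = 1 := by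
      rw [← map_one ofPoly, wcomp_ofPoly m.d_pos,
        (MvPolynomial.isWeightedHomogeneous_one ℂ m.d).weightedHomogeneousComponent_same]
    rw [h3, map_one, one_mul, add_comm] at h1
    exact h1

theorem isIntegralElem (hfin : f.IsFinite) (s : MvPolynomial (Fin n) ℂ) :
    (m.φ : MvPolynomial (Fin p) ℂ →+* MvPolynomial (Fin n) ℂ).IsIntegralElem s := by
  induction s using MvPolynomial.induction_on with
  | C r =>
    have := RingHom.isIntegralElem_map (m.φ : MvPolynomial (Fin p) ℂ →+* MvPolynomial (Fin n) ℂ)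
      (x := MvPolynomial.C r)
    simpa [Model.φ] using this
  | add q r hq hr => exact RingHom.IsIntegralElem.add _ hq hr
  | mul_X q i hq =>
    refine RingHom.IsIntegralElem.mul _ hq ?_
    obtain ⟨N, a, -, ha⟩ := m.exists_integral_equation hfin i
    refine ⟨Polynomial.X ^ N + ∑ k ∈ Finset.range N, Polynomial.C (a k) * Polynomial.X ^ k,
      Polynomial.monic_X_pow_add ?_, ?_⟩
    · rw [← Polynomial.mem_degreeLT]
      refine Submodule.sum_mem _ fun k hk => Polynomial.mem_degreeLT.2 ?_
      exact (Polynomial.degree_C_mul_X_pow_le k _).trans_lt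
        (by exact_mod_cast Finset.mem_range.1 hk)
    · simpa [Polynomial.eval₂_finsetSum] using ha

/-- Bimeromorphy of a map-germ implies birationality of its polynomial model. -/
theorem exists_fraction (hbim : f.IsBimeromorphicOntoImage) (s : MvPolynomial (Fin n) ℂ) :
    ∃ a b, m.φ b ≠ 0 ∧ m.φ b * s = m.φ a := by
  induction s using MvPolynomial.induction_on with
  | C r => exact ⟨MvPolynomial.C r, 1, by simp, by simp [Model.φ]⟩
  | add q r hq hr =>
    obtain ⟨a, b, hb, hab⟩ := hq
    obtain ⟨a', b', hb', hab'⟩ := hr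
    refine ⟨a * b' + a' * b, b * b', by rw [map_mul]; exact mul_ne_zero hb hb', ?_⟩
    rw [map_add, map_mul, map_mul, map_mul, ← hab, ← hab']
    ring
  | mul_X q i hq =>
    obtain ⟨a, b, hb, hab⟩ := hq
    obtain ⟨a', b', hb', hab'⟩ := hbim (coord i)
    -- Comparing parts of degree `w i + k` in the fraction for `x_i`, with `k` chosen so that the
    -- denominator has a nonzero part there, gives a fraction of polynomials.
    obtain ⟨k, hk, -⟩ := ofPoly_wcomp_lowest m.w_pos hb'
    have h1 := wcomp_ofPoly_mul m.w_pos (MvPolynomial.isWeightedHomogeneous_X ℂ m.w i) k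
      (f.pullback b')
    rw [ofPoly_X, mul_comm, hab', m.wcomp_pullback, m.wcomp_pullback] at h1
    rw [m.wcomp_pullback] at hk
    refine ⟨a * wcomp m.d (m.w i + k) a', b * wcomp m.d k b', ?_, ?_⟩
    · rw [map_mul]
      exact mul_ne_zero hb hk
    · rw [map_mul, map_mul, h1, ← hab]
      ring

end Model

/-- Divisibility by `H` among germs passes to each weighted component, and a polynomial is the sum
of its components; so the kernel of the germ map restricts to the expected kernel on polynomials. -/
theorem Equation.φ_eq_zero_iff {f : MapGerm n p} {m : Model f} {h : O p} (E : Equation m h)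
    (hh : f.IsImageEquation h) (a : MvPolynomial (Fin p) ℂ) : m.φ a = 0 ↔ E.H ∣ a := by
  have h1 : m.φ a = 0 ↔ ofPoly E.H ∣ ofPoly a := by
    rw [← E.h_dvd_iff, ← hh.pullback_eq_zero_iff, m.pullback_ofPoly,
      map_eq_zero_iff _ ofPoly_injective]
  rw [h1]
  refine ⟨fun h2 => ?_, fun h2 => map_dvd _ h2⟩
  have h3 := dvd_wcomp_of_ofPoly_dvd m.d_pos E.hom h2
  rw [← MvPolynomial.finsum_weightedHomogeneousComponent m.d a]
  refine finsum_induction (E.H ∣ ·) (dvd_zero _) (fun _ _ => dvd_add) fun k => ?_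
  rw [← wcomp_ofPoly m.d_pos]
  exact h3 k

/-- Iterating Hadamard's lemma places the remainder in an algebraic power of the maximal ideal, as
the Nakayama argument requires. -/
theorem exists_sub_ofPoly_mem_span_coord_pow (M : ℕ) (g : O n) :
    ∃ P : MvPolynomial (Fin n) ℂ, g - ofPoly P ∈ Ideal.span (Set.range (coord : Fin n → O n)) ^ M := by
  induction M generalizing g with
  | zero => exact ⟨0, by simp⟩
  | succ M ih =>
    obtain ⟨P, hP⟩ := exists_truncation g 1
    obtain ⟨q, hq⟩ := (Ideal.mem_span_range_iff_exists_fun).1 (exists_sum_coord hP)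
    choose Q hQ using fun i => ih (q i)
    refine ⟨P + ∑ i, Q i * MvPolynomial.X i, ?_⟩
    have : g - ofPoly (P + ∑ i, Q i * MvPolynomial.X i) =
        ∑ i, (q i - ofPoly (Q i)) * coord i := by
      simp only [map_add, map_sum, map_mul, ofPoly_X, sub_mul, Finset.sum_sub_distrib, hq]
      ring
    rw [this, pow_succ]
    exact Ideal.sum_mem _ fun i _ => Ideal.mul_mem_mul (hQ i) (Ideal.subset_span ⟨i, rfl⟩)

theorem vanish_one_le_jacobson : vanish n 1 ≤ Ideal.jacobson ⊥ := by
  intro g hg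
  rw [Ideal.mem_jacobson_bot]
  intro r
  refine isUnit_of_notMem_vanish fun hmem => one_notMem_vanish_one (n := n) ?_
  have h1 := Ideal.sub_mem _ hmem (Ideal.mul_mem_right r _ hg)
  rwa [add_sub_cancel_left] at h1

/-- A finite weighted homogeneous map-germ makes the ring of the source generated by polynomials
as a module over the ring of the target. -/
theorem Model.span_range_ofPoly {f : MapGerm n p} (m : Model f) (hfin : f.IsFinite) :
    Submodule.span (O p) (Set.range fun P : MvPolynomial (Fin n) ℂ =>
      (show f.PushForward from ofPoly P)) = ⊤ := by
  have hfin' : Module.Finite (O p) f.PushForward := hfin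
  set T := Submodule.span (O p) (Set.range fun P : MvPolynomial (Fin n) ℂ =>
      (show f.PushForward from ofPoly P)) with hT
  set K : Ideal (O n) := (vanish p 1).map (f.pullback : O p →+* O n) with hK
  -- The integral equations, with lower coefficients in the maximal ideal of the target, make each
  -- coordinate nilpotent modulo `K`. Hence a power of the maximal ideal of the source lies in `K`.
  have hrad : Ideal.span (Set.range (coord : Fin n → O n)) ≤ K.radical := by
    rw [Ideal.span_le]
    rintro _ ⟨i, rfl⟩
    obtain ⟨N, a, hav, ha⟩ := m.exists_integral_equation hfin i
    refine ⟨N, ?_⟩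
    have h1 := congrArg ofPoly ha
    rw [map_add, map_pow, ofPoly_X, map_sum, map_zero] at h1
    rw [eq_neg_of_add_eq_zero_left h1]
    refine Ideal.neg_mem_iff _ |>.2 (Ideal.sum_mem _ fun k hk => ?_)
    rw [map_mul, ← m.pullback_ofPoly]
    exact Ideal.mul_mem_right _ _ (Ideal.mem_map_of_mem _ (hav k (Finset.mem_range.1 hk)))
  obtain ⟨M, hM⟩ := Ideal.exists_pow_le_of_le_radical_of_fg hrad
    (Submodule.fg_span (Set.finite_range _))
  have hKT : ∀ x : O n, x ∈ K →
      (show f.PushForward from x) ∈ vanish p 1 • (⊤ : Submodule (O p) f.PushForward) := by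
    intro x hx
    rw [Ideal.smul_top_eq_map]
    exact hx
  rw [eq_top_iff]
  -- Nakayama: modulo the maximal ideal of the target, every germ is a polynomial.
  refine Submodule.le_of_le_smul_of_le_jacobson_bot hfin'.fg_top vanish_one_le_jacobson ?_
  intro g _
  obtain ⟨P, hP⟩ := exists_sub_ofPoly_mem_span_coord_pow M (show O n from g)
  have h1 : g = (show f.PushForward from ofPoly P) +
      (show f.PushForward from (show O n from g) - ofPoly P) :=
    (add_sub_cancel (ofPoly P) (show O n from g)).symm
  rw [h1]
  exact Submodule.add_mem_sup (Submodule.subset_span ⟨P, rfl⟩) (hKT _ (hM hP))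

/-- The Jacobian ideal of the image of a bimeromorphic finite map-germ is contained in the
conductor. -/
theorem Equation.exists_pullback_pderiv_mul {f : MapGerm n (n + 1)} {m : Model f} {h : O (n + 1)}
    (E : Equation m h) (hh : f.IsImageEquation h) (hfin : f.IsFinite)
    (hbim : f.IsBimeromorphicOntoImage) (j : Fin (n + 1)) (g : O n) :
    ∃ a, f.pullback a = f.pullback (pderiv j h) * g := by
  have hg : (show f.PushForward from g) ∈ Submodule.span (O (n + 1))
      (Set.range fun P : MvPolynomial (Fin n) ℂ => (show f.PushForward from ofPoly P)) := by
    rw [m.span_range_ofPoly hfin]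
    trivial
  refine Submodule.span_induction (p := fun (x : f.PushForward) _ =>
    ∃ a, f.pullback a = f.pullback (pderiv j h) * (show O n from x)) ?_ ?_ ?_ ?_ hg
  · rintro _ ⟨s, rfl⟩
    obtain ⟨a, ha⟩ := exists_map_pderiv_mul E.ne_zero (E.φ_eq_zero_iff hh)
      (m.isIntegralElem hfin) (m.exists_fraction hbim) j s
    refine ⟨E.u * ofPoly a, ?_⟩
    rw [E.pullback_pderiv hh, map_mul, m.pullback_ofPoly, ← ha, map_mul, mul_assoc]
  · exact ⟨0, by rw [map_zero]; exact (mul_zero _).symm⟩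
  · rintro x y - - ⟨a, ha⟩ ⟨b, hb⟩
    exact ⟨a + b, by rw [map_add, ha, hb]; exact (mul_add _ _ _).symm⟩
  · rintro r x - ⟨a, ha⟩
    refine ⟨r * a, ?_⟩
    rw [map_mul, ha]
    exact mul_left_comm _ _ _

/-! ### The maps to `N_f`: bijectivity of `MToN` and the kernel of `toN` -/

namespace MapGerm

variable {f : MapGerm n (n + 1)} {h : O (n + 1)}

theorem MToN_injective (hh : f.IsImageEquation h) (hJ : h ∈ jacobianIdeal h) :
    Function.Injective (f.MToN h) := by
  rw [injective_iff_map_eq_zero]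
  intro x hx
  obtain ⟨g, rfl⟩ := Submodule.Quotient.mk_surjective _ x
  have h1 : f.preJOToJOn h g ∈ (f.JOX h).submoduleOf (f.JOn h) :=
    (Submodule.Quotient.mk_eq_zero _).1 hx
  obtain ⟨g', hg', hgg'⟩ := h1
  rw [Submodule.Quotient.mk_eq_zero]
  change (g : O (n + 1)) ∈ jacobianIdeal h
  have h2 : f.pullback (g - g') = 0 := by
    rw [map_sub, sub_eq_zero]
    exact hgg'.symm
  obtain ⟨q, hq⟩ := hh.pullback_eq_zero_iff.1 h2
  have h3 : (g : O (n + 1)) = g' + h * q := by rw [← hq]; ring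
  rw [h3]
  exact Ideal.add_mem _ hg' (Ideal.mul_mem_right _ _ hJ)

theorem MToN_surjective
    (hc : ∀ (j : Fin (n + 1)) (g : O n), ∃ a, f.pullback a = f.pullback (pderiv j h) * g) :
    Function.Surjective (f.MToN h) := by
  intro y
  obtain ⟨⟨z, hz⟩, rfl⟩ := Submodule.Quotient.mk_surjective _ y
  have hz' : z ∈ Ideal.span (algebraMap (O (n + 1)) f.PushForward ''
      (Set.range fun j => pderiv j h)) := by
    rw [← Ideal.map_span]
    exact hz
  -- The extra factor `r` makes the claim stable under multiplication by elements of the source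
  -- ring, as induction over an ideal of that ring needs.
  have key : ∀ r : O n, ∃ a, f.pullback a = r * (show O n from z) := by
    refine Submodule.span_induction (p := fun (x : f.PushForward) _ =>
      ∀ r : O n, ∃ a, f.pullback a = r * (show O n from x)) ?_ ?_ ?_ ?_ hz'
    · rintro _ ⟨_, ⟨j, rfl⟩, rfl⟩ r
      obtain ⟨a, ha⟩ := hc j r
      exact ⟨a, ha.trans (mul_comm _ _)⟩
    · exact fun r => ⟨0, by rw [_root_.map_zero]; exact (mul_zero _).symm⟩
    · intro x y _ _ hx hy r
      obtain ⟨a, ha⟩ := hx r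
      obtain ⟨b, hb⟩ := hy r
      exact ⟨a + b, by rw [map_add, ha, hb]; exact (mul_add _ _ _).symm⟩
    · intro t x _ hx r
      obtain ⟨a, ha⟩ := hx (r * (show O n from t))
      exact ⟨a, ha.trans (mul_assoc _ _ _)⟩
  obtain ⟨a, ha⟩ := key 1
  rw [one_mul] at ha
  have ha' : algebraMap (O (n + 1)) f.PushForward a = z := ha
  refine ⟨Submodule.Quotient.mk ⟨a, ?_⟩, ?_⟩
  · change algebraMap (O (n + 1)) f.PushForward a ∈ f.JO h
    rw [ha']
    exact hz
  · change Submodule.Quotient.mk (f.preJOToJOn h ⟨a, _⟩) = _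
    congr 1
    exact Subtype.ext ha'

theorem sum_mem_JOn (v : Fin (n + 1) → O n) :
    (show f.PushForward from ∑ j, f.pullback (pderiv j h) * v j) ∈ f.JOn h := by
  change (show f.PushForward from ∑ j, f.pullback (pderiv j h) * v j) ∈ f.JO h
  refine Ideal.sum_mem (f.JO h) fun j _ => ?_
  have h1 : algebraMap (O (n + 1)) f.PushForward (pderiv j h) ∈ f.JO h :=
    Ideal.mem_map_of_mem _ (show pderiv j h ∈ jacobianIdeal h from Ideal.subset_span ⟨j, rfl⟩)
  exact Ideal.mul_mem_right (show f.PushForward from v j) (f.JO h) h1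

/-- The map `f^*Θ → N_f` given by pairing with the pull-back of the differential of `h`. -/
def toN (f : MapGerm n (n + 1)) (h : O (n + 1)) : (Fin (n + 1) → O n) →ₗ[ℂ] f.N h where
  toFun v := Submodule.Quotient.mk ⟨∑ j, f.pullback (pderiv j h) * v j, sum_mem_JOn v⟩
  map_add' v v' := by
    rw [← Submodule.Quotient.mk_add]
    congr 1
    apply Subtype.ext
    change (∑ j, f.pullback (pderiv j h) * (v j + v' j) : O n) =
      ∑ j, f.pullback (pderiv j h) * v j + ∑ j, f.pullback (pderiv j h) * v' j
    simp [mul_add, Finset.sum_add_distrib]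
  map_smul' c v := by
    rw [RingHom.id_apply, ← Submodule.Quotient.mk_smul]
    congr 1
    apply Subtype.ext
    change (∑ j, f.pullback (pderiv j h) * (c • v j) : O n) =
      c • ∑ j, f.pullback (pderiv j h) * v j
    simp [Finset.smul_sum]

theorem toN_surjective : Function.Surjective (f.toN h) := by
  intro y
  obtain ⟨⟨z, hz⟩, rfl⟩ := Submodule.Quotient.mk_surjective _ y
  have hz' : z ∈ Ideal.span (Set.range fun j => algebraMap (O (n + 1)) f.PushForward (pderiv j h)) := by
    have : (Set.range fun j => algebraMap (O (n + 1)) f.PushForward (pderiv j h)) =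
        algebraMap (O (n + 1)) f.PushForward '' (Set.range fun j => pderiv j h) := by
      rw [← Set.range_comp]
      rfl
    rw [this, ← Ideal.map_span]
    exact hz
  obtain ⟨v, hv⟩ := Ideal.mem_span_range_iff_exists_fun.1 hz'
  have h1 : ∑ j, f.pullback (pderiv j h) * (show O n from v j) =
      ∑ j, (show O n from v j) * f.pullback (pderiv j h) :=
    Finset.sum_congr rfl fun j _ => mul_comm _ _
  refine ⟨v, ?_⟩
  change Submodule.Quotient.mk _ = _
  congr 1
  apply Subtype.ext
  exact h1.trans hv

theorem toN_eq_zero_iff {v : Fin (n + 1) → O n} : f.toN h v = 0 ↔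
    ∃ η : Fin (n + 1) → O (n + 1), ∑ j, f.pullback (pderiv j h) * v j =
      ∑ j, f.pullback (pderiv j h) * f.pullback (η j) := by
  have h1 : f.toN h v = 0 ↔
      (show f.PushForward from ∑ j, f.pullback (pderiv j h) * v j) ∈ f.JOX h :=
    Submodule.Quotient.mk_eq_zero _
  rw [h1]
  constructor
  · rintro ⟨g, hg, hgv⟩
    obtain ⟨η, hη⟩ := Ideal.mem_span_range_iff_exists_fun.1 hg
    refine ⟨η, ?_⟩
    have h2 : f.pullback g = ∑ j, f.pullback (pderiv j h) * v j := hgv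
    rw [← h2, ← hη, map_sum]
    refine Finset.sum_congr rfl fun j _ => ?_
    rw [map_mul, mul_comm]
  · rintro ⟨η, hη⟩
    refine ⟨∑ j, pderiv j h * η j, Ideal.sum_mem _ fun j _ => Ideal.mul_mem_right _ _
      (Ideal.subset_span ⟨j, rfl⟩), ?_⟩
    change f.pullback (∑ j, pderiv j h * η j) = ∑ j, f.pullback (pderiv j h) * v j
    rw [hη, map_sum]
    simp only [map_mul]

/-- The chain rule applied to `h ∘ f = 0`. -/
theorem vecMul_jacobianMatrix (hpb : f.pullback h = 0) :
    Matrix.vecMul (fun j => f.pullback (pderiv j h)) f.jacobianMatrix = 0 := by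
  ext i
  have h1 := pderiv_pullback f h i
  have h2 : pderiv i (0 : O n) = 0 := by
    have := pderiv_ofPoly i (0 : MvPolynomial (Fin n) ℂ)
    simpa using this
  rw [hpb, h2] at h1
  exact h1.symm

/-- If the pairing of `v` with `c` agrees with that of `η ∘ f`, then `c` kills `v - η ∘ f`, which
therefore lies in the image of `df` by the codimension hypothesis. The reverse inclusion is `c · df
= 0` together with the definition of `J_h 𝒪_X`. -/
theorem ker_toN (m : Model f) (E : Equation m h) (hh : f.IsImageEquation h)
    (hr : 2 ≤ f.ramificationCodim) :
    LinearMap.ker (f.toN h) = LinearMap.range f.tf ⊔ LinearMap.range f.ωf := by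
  set c : Fin (n + 1) → O n := fun j => f.pullback (pderiv j h) with hc
  have hc0 : c ≠ 0 := fun h0 => by
    obtain ⟨j, hj⟩ := E.exists_pullback_pderiv_ne_zero hh
    exact hj (congrFun h0 j)
  have hcA : Matrix.vecMul c f.jacobianMatrix = 0 :=
    vecMul_jacobianMatrix (hh.pullback_eq_zero_iff.2 dvd_rfl)
  apply le_antisymm
  · intro v hv
    obtain ⟨η, hη⟩ := toN_eq_zero_iff.1 (LinearMap.mem_ker.1 hv)
    have h1 : dotProduct c (v - f.ωf η) = 0 := by
      rw [dotProduct_sub, sub_eq_zero]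
      exact hη
    obtain ⟨ξ, hξ⟩ := m.mem_range_mulVec hr hc0 hcA h1
    have h2 : v = f.tf ξ + f.ωf η := by
      change v = f.jacobianMatrix.mulVec ξ + f.ωf η
      rw [hξ, sub_add_cancel]
    rw [h2]
    exact Submodule.add_mem_sup ⟨ξ, rfl⟩ ⟨η, rfl⟩
  · refine sup_le ?_ ?_
    · rintro _ ⟨ξ, rfl⟩
      rw [LinearMap.mem_ker, toN_eq_zero_iff]
      refine ⟨0, ?_⟩
      change dotProduct c (f.jacobianMatrix.mulVec ξ) = _
      rw [Matrix.dotProduct_mulVec, hcA]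
      simp
    · rintro _ ⟨η, rfl⟩
      rw [LinearMap.mem_ker, toN_eq_zero_iff]
      exact ⟨η, rfl⟩

end MapGerm

end

end MondGerm

end

open MondGerm in
theorem proposition3p1 (n : ℕ) (f : MapGerm n (n + 1))
    (hfin : f.IsFinite) (hwh : f.IsWeightedHomogeneous)
    (h : O (n + 1)) (hh : f.IsImageEquation h) :
    (f.IsBimeromorphicOntoImage → Function.Bijective (f.MToN h)) ∧
    (2 ≤ f.ramificationCodim → Module.rank ℂ (f.N h) = f.AeCodim) := by
  obtain ⟨m⟩ := hwh.exists_model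
  obtain ⟨E⟩ := hh.exists_equation m (hh.ne_zero m)
  refine ⟨fun hbim => ⟨MapGerm.MToN_injective hh E.mem_jacobianIdeal,
    MapGerm.MToN_surjective (E.exists_pullback_pderiv_mul hh hfin hbim)⟩, fun hr => ?_⟩
  change Module.rank ℂ (f.N h) =
    Module.rank ℂ ((Fin (n + 1) → O n) ⧸ (LinearMap.range f.tf ⊔ LinearMap.range f.ωf))
  rw [← MapGerm.ker_toN m E hh hr]
  exact ((f.toN h).quotKerEquivOfSurjective MapGerm.toN_surjective).rank_eq.symm
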